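/- Let $\theta_5 = \frac{1+2i}{1-2i}$ and $\theta_{13} = \frac{2+3i}{2-3i}$, and for an integer $N \ge 0$ let \[ \Theta_N = \{\theta_5^r\, \theta_{13}^s : r, s \in \mathbb{Z},\ 0 \le r, s \le N\}. \] For $\varepsilon > 0$ let $E = \{z \in \mathbb{C} : |\mathrm{Re}(z) - m| < \varepsilon \text{ for some } m \in \mathbb{Z}\}$, and for a unit complex number $\theta$ let $E_\theta = \theta^{-1} E$. (Rationality lemma) For every $\varepsilon > 0$ there is an integer $n \ge 1$, depending only on $\varepsilon$, such that for every real $R$ there exist $D \in \mathbb{Z}[i]$ with $|D| \ge R$ and an integer $N \ge 0$ with the following property: every point $z \in \mathbb{C} \setminus \bigcup_{\theta \in \Theta_N} E_\theta$ is at distance at most $20$ from some $r \in \frac{1}{n} D\,\mathbb{Z}[i]$ with $r \notin D\,\mathbb{Z}[i]$. -/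

import Mathlib

open scoped Pointwise

namespace Pyjama

noncomputable section

/-- The pyjama stripe: the points whose real part is within `ε` of an integer. -/
def stripe (ε : ℝ) : Set ℂ := {z | ∃ m : ℤ, |z.re - m| < ε}

/-- The rotated pyjama stripe `θ⁻¹ E`. -/
def rotatedStripe (ε : ℝ) (θ : ℂ) : Set ℂ := θ⁻¹ • stripe ε

/-- The Gaussian prime `1 + 2i` above `5`. -/
def P5 : GaussianInt := ⟨1, 2⟩

/-- The Gaussian prime `2 + 3i` above `13`. -/
def P13 : GaussianInt := ⟨2, 3⟩

/-- The unit complex number `(1 + 2i) / (1 - 2i)`. -/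
def theta5 : ℂ := (P5 : ℂ) / (starRingEnd ℂ) (P5 : ℂ)

/-- The unit complex number `(2 + 3i) / (2 - 3i)`. -/
def theta13 : ℂ := (P13 : ℂ) / (starRingEnd ℂ) (P13 : ℂ)

/-- The finite set of rotations `θ₅ ^ r * θ₁₃ ^ s` with `0 ≤ r, s ≤ N`. -/
def Theta (N : ℕ) : Set ℂ :=
  {θ | ∃ r s : ℕ, r ≤ N ∧ s ≤ N ∧ θ = theta5 ^ r * theta13 ^ s}

/-- The set `c ℤ[i]` of all Gaussian integer multiples of the complex number `c`. -/
def gaussianMultiples (c : ℂ) : Set ℂ := {w | ∃ k : GaussianInt, w = c * (k : ℂ)}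

end

end Pyjama

/-!
The uncovered points `z` are studied through the compact solenoid dual to `ℤ[i][1 / 65]`, on which
`θ₅` and `θ₁₃` act invertibly. It contains `ℂ` as a dense leaf (`line`) and looks locally like the
product of `ℂ`, on which the action is by isometries, with a totally disconnected group that has one
factor for each of the four Gaussian primes `P` above `5` and `13`. Multiplication by `star P / P`
expands the factor at `P`, while the rotation attached to the other rational prime acts on this factor
by a unit whose powers are dense in an open subgroup of the local units.

The proof follows Furstenberg's argument for the multiplications by `2` and `3`. By
`solenoid_subset_of_accumulates`, a closed invariant set that accumulates at the complex leaf in a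
totally disconnected direction is the whole solenoid: expansion and rotation spread the displacement
over a fine lattice, and a joint approximation lemma (`IsPlace.exists_pow_congr_near`) allows the
complex component to be kept almost fixed meanwhile. If a closed invariant set avoids the stripe, a
descent through differences (`exists_fixed_of_avoidsStripe`) finds rational points, up to translation
along the leaf, in its set of transversal accumulation points, should that be nonempty; translating
such a point to the leaf gives a contradiction. So the set meets only finitely many leaves
(`meetsFinitelyManyLeaves_of_avoidsStripe`), the rotations permute these, and every point is the sum of
a torsion point of bounded order `n` and of a translation along the leaf of length at most `1`
(`exists_torsion_of_avoidsStripe`).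

By compactness, `M` consecutive exponents on either side suffice to place an uncovered point near
a point of `(65 ^ k / n) ℤ[i]`. When `z` is uncovered for all exponents up to `2 * M + L`, this applies
to all the points `(θ₅ * θ₁₃) ^ (M + j) * z` with `j ≤ L`. Since `65 ^ k` is large compared with `n`,
the nearby rational points are rotated into each other exactly (`P65_mul_eq`), which forces them to be
divisible by large powers of the denominator of `θ₅ * θ₁₃`. The first `M` steps cost only the factor
`65 ^ M` in `n`. The rational point is not in `D ℤ[i]` because all points within `20` of `D ℤ[i]` are
covered.
-/

open scoped Pointwise

namespace Pyjama

/-! ### Powers of rotations and their approximation properties -/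

/-- Kronecker density on the circle: the nonnegative powers of a unit complex number that is not a
root of unity come arbitrarily close to every unit complex number. -/
theorem exists_pow_near {ω : ℂ} (hω : ‖ω‖ = 1) (hn : ∀ k : ℕ, 0 < k → ω ^ k ≠ 1)
    {u : ℂ} (hu : ‖u‖ = 1) {η : ℝ} (hη : 0 < η) : ∃ k : ℕ, ‖ω ^ k - u‖ < η := by
  have : Fact (0 < 2 * Real.pi) := ⟨Real.two_pi_pos⟩
  have key : ∀ v : ℂ, ‖v‖ = 1 →
      ((AddCircle.toCircle ((Complex.arg v : ℝ) : AddCircle (2 * Real.pi)) : Circle) : ℂ) = v := by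
    intro v hv
    rw [AddCircle.toCircle_apply_mk, Circle.coe_exp, div_self Real.two_pi_pos.ne', one_mul]
    have := Complex.norm_mul_exp_arg_mul_I v
    rwa [hv, Complex.ofReal_one, one_mul] at this
  set a : AddCircle (2 * Real.pi) := ((Complex.arg ω : ℝ) : AddCircle (2 * Real.pi)) with ha
  set b : AddCircle (2 * Real.pi) := ((Complex.arg u : ℝ) : AddCircle (2 * Real.pi)) with hb
  have hpow : ∀ k : ℕ, ((AddCircle.toCircle (k • a) : Circle) : ℂ) = ω ^ k := by
    intro k
    rw [AddCircle.toCircle_nsmul, Circle.coe_pow, key ω hω]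
  have hord : addOrderOf a = 0 := by
    rw [addOrderOf_eq_zero_iff']
    intro k hk h0
    apply hn k hk
    rw [← hpow k, h0, AddCircle.toCircle_zero, Circle.coe_one]
  have hd : DenseRange (fun k : ℕ => k • a) :=
    denseRange_zsmul_iff_nsmul.mp (AddCircle.denseRange_zsmul_iff.mpr hord)
  have hc : Continuous fun t : AddCircle (2 * Real.pi) => ((AddCircle.toCircle t : Circle) : ℂ) :=
    continuous_subtype_val.comp AddCircle.continuous_toCircle
  have hopen : IsOpen {t : AddCircle (2 * Real.pi) |
      ‖((AddCircle.toCircle t : Circle) : ℂ) - u‖ < η} :=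
    isOpen_lt (by fun_prop) continuous_const
  obtain ⟨k, hk⟩ := hd.exists_mem_open hopen ⟨b, by
    show ‖((AddCircle.toCircle b : Circle) : ℂ) - u‖ < η
    rw [key u hu]; simpa using hη⟩
  exact ⟨k, by simpa [hpow] using hk⟩

/-- The arithmetic of a Gaussian prime `P` above the rational prime `p`, together with a Gaussian
integer `Q` whose norm is the complementary divisor of `65`. The element `star P / P` will be used to
expand at the place `P`; the element `star Q / Q` is a unit at `P`. -/
structure IsPlace (P Q : GaussianInt) (p : ℕ) : Prop where
  mul_star : P * star P = p
  odd : Odd p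
  mul_eq : P * star P * (Q * star Q) = 65
  prime : Prime P
  coprime_star : IsCoprime P (star P)
  coprime_left : IsCoprime P Q
  coprime_right : IsCoprime P (star Q)
  coprime_Q : IsCoprime Q (star Q)
  not_isUnit : ¬ IsUnit Q
  /-- Every Gaussian integer is congruent to a rational one modulo `P`, since `i` is. -/
  residue : ∃ r : ℤ, P ∣ (⟨-r, 1⟩ : GaussianInt)
  /-- Some power of `star Q / Q` is congruent to `1` modulo `p`. -/
  cong : ∃ s : ℕ, 0 < s ∧ (p : GaussianInt) ∣ star Q ^ s - Q ^ s

theorem prime_of_norm_prime {P : GaussianInt} (h : Prime P.norm) : Prime P := by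
  rw [← irreducible_iff_prime]
  refine ⟨fun hu => h.not_isUnit ((Zsqrtd.isUnit_iff_norm_isUnit P).mp hu), fun a b hab => ?_⟩
  rw [Zsqrtd.isUnit_iff_norm_isUnit, Zsqrtd.isUnit_iff_norm_isUnit]
  exact h.irreducible.isUnit_or_isUnit (by rw [hab, Zsqrtd.norm_mul])

theorem isPlace_five {P Q : GaussianInt} (hP : P = P5 ∨ P = star P5)
    (hQ : Q = P13 ∨ Q = star P13) : IsPlace P Q 5 := by
  have hP1 : P * star P = 5 := by rcases hP with rfl | rfl <;> decide
  have hP2 : P + star P = 2 := by rcases hP with rfl | rfl <;> decide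
  have hQ1 : Q * star Q = 13 := by rcases hQ with rfl | rfl <;> decide
  have hQ2 : Q + star Q = 4 := by rcases hQ with rfl | rfl <;> decide
  have hPn : P.norm = 5 := by rcases hP with rfl | rfl <;> decide
  have hQn : Q.norm = 13 := by rcases hQ with rfl | rfl <;> decide
  refine ⟨hP1, by decide, by rw [hP1, hQ1]; decide, prime_of_norm_prime ?_,
    ⟨star P - 2, -2, by linear_combination hP1 - 2 * hP2⟩,
    ⟨-5 * star P, 2 * star Q, by linear_combination -5 * hP1 + 2 * hQ1⟩,
    ⟨-5 * star P, 2 * Q, by linear_combination -5 * hP1 + 2 * hQ1⟩,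
    ⟨star Q - 3, -3, by linear_combination hQ1 - 3 * hQ2⟩, ?_, ?_, 4, by norm_num, ?_⟩
  · rw [hPn]; norm_num
  · rw [← Zsqrtd.norm_eq_one_iff, hQn]; decide
  · rcases hP with rfl | rfl
    · exact ⟨2, ⟨0, 1⟩, by decide⟩
    · exact ⟨-2, ⟨0, 1⟩, by decide⟩
  · rcases hQ with rfl | rfl
    · exact ⟨⟨0, 48⟩, by decide⟩
    · exact ⟨⟨0, -48⟩, by decide⟩

theorem isPlace_thirteen {P Q : GaussianInt} (hP : P = P13 ∨ P = star P13)
    (hQ : Q = P5 ∨ Q = star P5) : IsPlace P Q 13 := by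
  have hP1 : P * star P = 13 := by rcases hP with rfl | rfl <;> decide
  have hP2 : P + star P = 4 := by rcases hP with rfl | rfl <;> decide
  have hQ1 : Q * star Q = 5 := by rcases hQ with rfl | rfl <;> decide
  have hQ2 : Q + star Q = 2 := by rcases hQ with rfl | rfl <;> decide
  have hPn : P.norm = 13 := by rcases hP with rfl | rfl <;> decide
  have hQn : Q.norm = 5 := by rcases hQ with rfl | rfl <;> decide
  refine ⟨hP1, by decide, by rw [hP1, hQ1]; decide, prime_of_norm_prime ?_,
    ⟨star P - 3, -3, by linear_combination hP1 - 3 * hP2⟩,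
    ⟨2 * star P, -5 * star Q, by linear_combination 2 * hP1 - 5 * hQ1⟩,
    ⟨2 * star P, -5 * Q, by linear_combination 2 * hP1 - 5 * hQ1⟩,
    ⟨star Q - 2, -2, by linear_combination hQ1 - 2 * hQ2⟩, ?_, ?_, 12, by norm_num, ?_⟩
  · rw [hPn]; norm_num
  · rw [← Zsqrtd.norm_eq_one_iff, hQn]; decide
  · rcases hP with rfl | rfl
    · exact ⟨8, ⟨-1, 2⟩, by decide⟩
    · exact ⟨-8, ⟨1, 2⟩, by decide⟩
  · rcases hQ with rfl | rfl
    · exact ⟨⟨0, -1584⟩, by decide⟩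
    · exact ⟨⟨0, 1584⟩, by decide⟩

theorem star_pow_ne_pow {Q : GaussianInt} (h : IsCoprime Q (star Q)) (hu : ¬ IsUnit Q)
    {k : ℕ} (hk : 0 < k) : star Q ^ k ≠ Q ^ k := by
  intro he
  have h1 : IsCoprime (Q ^ k) (star Q ^ k) := h.pow
  rw [he, isCoprime_self, isUnit_pow_iff hk.ne'] at h1
  exact hu h1

/-- Lifting the exponent at the Gaussian prime `P` above the odd prime `p`: raising to the power `p`
adds exactly one factor `P` to the difference of two numbers that are congruent modulo `p`. The point
is that `p = P * star P` contains the factor `P` exactly once. -/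
theorem exists_pow_prime_pow_sub {P x y γ : GaussianInt} {p c : ℕ} (hp : P * star P = p)
    (hodd : Odd p) (hP : Prime P) (hP' : ¬ P ∣ star P) (hxy : (p : GaussianInt) ∣ x - y)
    (hc : x - y = P ^ c * γ) (hγ : ¬ P ∣ γ) (hy : ¬ P ∣ y) (i : ℕ) :
    ∃ γ', x ^ p ^ i - y ^ p ^ i = P ^ (c + i) * γ' ∧ ¬ P ∣ γ' := by
  suffices h : (p : GaussianInt) ∣ x ^ p ^ i - y ^ p ^ i ∧
      ∃ γ', x ^ p ^ i - y ^ p ^ i = P ^ (c + i) * γ' ∧ ¬ P ∣ γ' from h.2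
  induction i with
  | zero => simpa using ⟨hxy, γ, hc, hγ⟩
  | succ i ih =>
    obtain ⟨⟨b, hb⟩, γ', h1, h2⟩ := ih
    set X := x ^ p ^ i
    set Y := y ^ p ^ i
    have hX : X = Y + p * b := by rw [← hb]; ring
    obtain ⟨e, he⟩ := odd_sq_dvd_geom_sum₂_sub (a := Y) (b := b) hodd
    have hgeom := (Commute.all X Y).geom_sum₂_mul p
    rw [hX] at hgeom
    have hfac : x ^ p ^ (i + 1) - y ^ p ^ (i + 1) =
        P ^ (c + (i + 1)) * (γ' * (star P * (Y ^ (p - 1) + p * e))) := by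
      have : x ^ p ^ (i + 1) - y ^ p ^ (i + 1) = X ^ p - Y ^ p := by
        simp only [X, Y, ← pow_mul, pow_succ]
      rw [this, hX, ← hgeom, eq_add_of_sub_eq he]
      have h3 : Y + p * b - Y = P ^ (c + i) * γ' := by rw [← hX, h1]
      rw [h3]
      linear_combination (-(Y ^ (p - 1) + p * e) * P ^ (c + i) * γ') * hp
    refine ⟨?_, _, hfac, ?_⟩
    · have : x ^ p ^ (i + 1) - y ^ p ^ (i + 1) = X ^ p - Y ^ p := by
        simp only [X, Y, ← pow_mul, pow_succ]
      rw [this]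
      exact (Dvd.intro _ hb.symm).trans (sub_dvd_pow_sub_pow X Y p)
    · intro hd
      rcases hP.dvd_or_dvd hd with h | h
      · exact h2 h
      rcases hP.dvd_or_dvd h with h | h
      · exact hP' h
      have h5 : P ∣ Y ^ (p - 1) := by
        refine (dvd_add_left ?_).mp h
        rw [← hp, mul_assoc]; exact dvd_mul_right _ _
      exact hy (hP.dvd_of_dvd_pow (hP.dvd_of_dvd_pow h5))

theorem IsPlace.exists_nat_residue {P Q : GaussianInt} {p : ℕ} (h : IsPlace P Q p)
    (g : GaussianInt) : ∃ k : ℕ, P ∣ g - k := by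
  obtain ⟨r, hr⟩ := h.residue
  have hp0 : (0 : ℤ) < p := by
    rcases h.odd with ⟨k, rfl⟩; positivity
  have hPp : P ∣ (p : GaussianInt) := h.mul_star ▸ dvd_mul_right _ _
  obtain ⟨k, hk⟩ := Int.eq_ofNat_of_zero_le (Int.emod_nonneg (g.re + g.im * r) hp0.ne')
  refine ⟨k, ?_⟩
  have h1 := Int.emod_add_mul_ediv (g.re + g.im * r) p
  have h2 : g - k = (g.im : GaussianInt) * ⟨-r, 1⟩
      + (p : GaussianInt) * (((g.re + g.im * r) / p : ℤ) : GaussianInt) := by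
    have h3 : ((k : ℤ) : GaussianInt) = k := by simp
    rw [← h3, ← hk, Int.emod_def]
    ext
    · simp
      ring
    · simp
  rw [h2]
  exact dvd_add (hr.mul_left _) (hPp.mul_right _)


theorem IsPlace.not_dvd_star {P Q : GaussianInt} {p : ℕ} (h : IsPlace P Q p) : ¬ P ∣ star P :=
  fun hd => h.prime.not_isUnit (h.coprime_star.isUnit_of_dvd' dvd_rfl hd)

theorem IsPlace.not_dvd_pow {P Q : GaussianInt} {p : ℕ} (h : IsPlace P Q p) (k : ℕ) :
    ¬ P ∣ Q ^ k :=
  fun hd => h.prime.not_isUnit (h.coprime_left.isUnit_of_dvd' dvd_rfl (h.prime.dvd_of_dvd_pow hd))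

theorem IsPlace.not_dvd_star_pow {P Q : GaussianInt} {p : ℕ} (h : IsPlace P Q p) (k : ℕ) :
    ¬ P ∣ star Q ^ k :=
  fun hd => h.prime.not_isUnit (h.coprime_right.isUnit_of_dvd' dvd_rfl (h.prime.dvd_of_dvd_pow hd))

/-- The powers of `star Q / Q` with exponent in `m ℕ` are dense, at the place `P`, in the
neighbourhood `1 + P ^ c ℤ[i]` of `1`. -/
theorem IsPlace.exists_pow_congr {P Q : GaussianInt} {p : ℕ} (h : IsPlace P Q p) {m : ℕ}
    (hm : 0 < m) : ∃ c : ℕ, ∀ (B : ℕ) (t : GaussianInt), ∃ s : ℕ, m ∣ s ∧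
      P ^ B ∣ star Q ^ s - (1 + P ^ c * t) * Q ^ s := by
  obtain ⟨s₀, hs₀, hcong⟩ := h.cong
  set α := star Q ^ (m * s₀) with hα
  set β := Q ^ (m * s₀) with hβ
  have hne : α - β ≠ 0 :=
    sub_ne_zero.mpr (star_pow_ne_pow h.coprime_Q h.not_isUnit (Nat.mul_pos hm hs₀))
  have hpαβ : (p : GaussianInt) ∣ α - β := by
    rw [hα, hβ, mul_comm, pow_mul, pow_mul]
    exact hcong.trans (sub_dvd_pow_sub_pow _ _ _)
  obtain ⟨c, γ, hγ, hc⟩ := WfDvdMonoid.max_power_factor hne h.prime.irreducible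
  have hPp : P ∣ (p : GaussianInt) := h.mul_star ▸ dvd_mul_right _ _
  have hc1 : 1 ≤ c := by
    by_contra hc0
    obtain rfl : c = 0 := by omega
    rw [pow_zero, one_mul] at hc
    exact hγ (hc ▸ hPp.trans hpαβ)
  have hkey : ∀ (i : ℕ) (t : GaussianInt),
      ∃ n : ℕ, P ^ (c + i) ∣ α ^ n - (1 + P ^ c * t) * β ^ n := by
    intro i t
    induction i with
    | zero => exact ⟨0, -t, by ring⟩
    | succ i ih =>
      obtain ⟨n, w, hw⟩ := ih
      obtain ⟨γ', h1, h2⟩ := exists_pow_prime_pow_sub h.mul_star h.odd h.prime h.not_dvd_star hpαβ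
        hc hγ (h.not_dvd_pow _) i
      set X := α ^ p ^ i
      set x := β ^ p ^ i
      have hcop : IsCoprime (α ^ n * γ') P := by
        refine (h.prime.irreducible.coprime_iff_not_dvd.mpr fun hd => ?_).symm
        rcases h.prime.dvd_or_dvd hd with hd | hd
        · rw [hα, ← pow_mul] at hd
          exact h.not_dvd_star_pow _ hd
        · exact h2 hd
      obtain ⟨a, b, hab⟩ := hcop
      -- Multiplying by the `(k + 1)`-th power of `X / x`, which is `1` up to exactly `P ^ (c + i)`,
      -- corrects the next digit of the approximation.
      obtain ⟨k, l, hk⟩ := h.exists_nat_residue (-(a * w * x) - 1)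
      obtain ⟨z, hz⟩ := Polynomial.powAddExpansion x (P ^ (c + i) * γ') (k + 1)
      obtain ⟨c, rfl⟩ : ∃ c', c = c' + 1 := ⟨c - 1, by omega⟩
      rw [← h1, add_sub_cancel, h1, Nat.add_sub_cancel, Nat.cast_add, Nat.cast_one] at hz
      have hk' : (k : GaussianInt) + 1 = -(a * w * x) - P * l := by rw [← hk]; ring
      refine ⟨n + p ^ i * (k + 1), x ^ k * (w * x * b - α ^ n * γ' * l)
        + α ^ n * z * P ^ (c + i) * γ' ^ 2, ?_⟩
      have hX : α ^ (n + p ^ i * (k + 1)) = α ^ n * X ^ (k + 1) := by rw [pow_add, pow_mul]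
      have hx : β ^ (n + p ^ i * (k + 1)) = β ^ n * x ^ (k + 1) := by rw [pow_add, pow_mul]
      rw [hX, hx, hz, hk']
      linear_combination x ^ (k + 1) * hw - P ^ (c + 1 + i) * x ^ (k + 1) * w * hab
  refine ⟨c, fun B t => ?_⟩
  obtain ⟨n, hn⟩ := hkey B t
  refine ⟨m * s₀ * n, ⟨s₀ * n, by ring⟩, ?_⟩
  rw [pow_mul _ (m * s₀), pow_mul Q (m * s₀)]
  exact (pow_dvd_pow P (Nat.le_add_left B c)).trans hn

/-- The unit complex number `star P / P`. -/
noncomputable def rotation (P : GaussianInt) : ℂ := (star P : GaussianInt) / P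

theorem norm_rotation {P : GaussianInt} (h : P ≠ 0) : ‖rotation P‖ = 1 := by
  rw [rotation, norm_div, GaussianInt.toComplex_star, Complex.norm_conj, div_self]
  simpa using h

theorem rotation_pow_ne_one {Q : GaussianInt} (h : IsCoprime Q (star Q)) (hu : ¬ IsUnit Q)
    {k : ℕ} (hk : 0 < k) : rotation Q ^ k ≠ 1 := by
  intro he
  have hQ : (Q : ℂ) ≠ 0 := by
    rw [Ne, GaussianInt.toComplex_eq_zero]
    rintro rfl
    rw [star_zero, isCoprime_zero_left] at h
    exact not_isUnit_zero h
  apply star_pow_ne_pow h hu hk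
  rw [rotation, div_pow, div_eq_one_iff_eq (pow_ne_zero _ hQ)] at he
  rw [← map_pow, ← map_pow] at he
  exact GaussianInt.toComplex_inj.mp he

theorem IsPlace.ne_zero_right {P Q : GaussianInt} {p : ℕ} (h : IsPlace P Q p) : Q ≠ 0 := by
  rintro rfl
  have := h.mul_eq
  rw [zero_mul, mul_zero] at this
  exact absurd this (by decide)

/-- The powers of `star Q / Q` approximate prescribed elements of `1 + P ^ c ℤ[i]` at the place `P`
and, simultaneously, `1` in the complex absolute value. The exponents are bounded uniformly in the
prescribed element, because only its residue modulo `p ^ B` matters. -/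
theorem IsPlace.exists_pow_congr_near {P Q : GaussianInt} {p : ℕ} (h : IsPlace P Q p) {m : ℕ}
    (hm : 0 < m) : ∃ c : ℕ, ∀ (B : ℕ) (η : ℝ), 0 < η → ∃ S : ℕ, ∀ t : GaussianInt,
      ∃ s ≤ S, m ∣ s ∧ P ^ B ∣ star Q ^ s - (1 + P ^ c * t) * Q ^ s ∧
        ‖rotation Q ^ s - 1‖ < η := by
  obtain ⟨c, hc⟩ := h.exists_pow_congr hm
  refine ⟨c, fun B η hη => ?_⟩
  have hcong : ∃ e, 0 < e ∧ P ^ B ∣ star Q ^ e -Q ^ e := by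
    obtain ⟨s₀, hs₀, hcong⟩ := h.cong
    have hp : 0 < p := h.odd.pos
    refine ⟨s₀ * p ^ B, by positivity, ?_⟩
    rw [pow_mul, pow_mul]
    refine Dvd.dvd.trans ?_ (dvd_sub_pow_of_dvd_sub hcong B)
    exact (pow_dvd_pow P (Nat.le_succ B)).trans (pow_dvd_pow_of_dvd (h.mul_star ▸ dvd_mul_right _ _) _)
  obtain ⟨e, he, hPe⟩ := hcong
  have hone : ∀ t : GaussianInt, ∃ s : ℕ, m ∣ s ∧
      P ^ B ∣ star Q ^ s - (1 + P ^ c * t) * Q ^ s ∧ ‖rotation Q ^ s - 1‖ < η := by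
    intro t
    obtain ⟨s, hs, hPs⟩ := hc B t
    have hnorm := norm_rotation h.ne_zero_right
    -- Adding multiples of `e * m` to the exponent keeps the congruence and moves the argument densely.
    obtain ⟨k, hk⟩ := exists_pow_near (ω := rotation Q ^ (e * m))
      (by rw [norm_pow, hnorm, one_pow])
      (fun k hk => by
        rw [← pow_mul]
        exact rotation_pow_ne_one h.coprime_Q h.not_isUnit (by positivity))
      (u := (rotation Q ^ s)⁻¹) (by rw [norm_inv, norm_pow, hnorm, one_pow, inv_one]) hη
    refine ⟨s + e * m * k, dvd_add hs ⟨e * k, by ring⟩, ?_, ?_⟩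
    · have h1 : P ^ B ∣ star Q ^ (e * m * k) - Q ^ (e * m * k) := by
        rw [mul_assoc, pow_mul, pow_mul Q]
        exact hPe.trans (sub_dvd_pow_sub_pow _ _ _)
      have h2 : star Q ^ (s + e * m * k) - (1 + P ^ c * t) * Q ^ (s + e * m * k) =
          (star Q ^ s - (1 + P ^ c * t) * Q ^ s) * star Q ^ (e * m * k) +
          (1 + P ^ c * t) * Q ^ s * (star Q ^ (e * m * k) - Q ^ (e * m * k)) := by ring
      rw [h2]
      exact dvd_add (hPs.mul_right _) (h1.mul_left _)
    · have hne : rotation Q ^ s ≠ 0 := by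
        rw [← norm_ne_zero_iff, norm_pow, hnorm]; simp
      have h3 : rotation Q ^ (s + e * m * k) - 1 =
          rotation Q ^ s * ((rotation Q ^ (e * m)) ^ k - (rotation Q ^ s)⁻¹) := by
        rw [mul_sub, mul_inv_cancel₀ hne, ← pow_mul, ← pow_add]
      rw [h3, norm_mul, norm_pow, hnorm, one_pow, one_mul]
      exact hk
  choose s hs1 hs2 hs3 using hone
  have hp0 : (0 : ℤ) < (p : ℤ) ^ B := by
    rcases h.odd with ⟨k, rfl⟩; positivity
  set F : Finset (ℤ × ℤ) := Finset.Icc 0 ((p : ℤ) ^ B) ×ˢ Finset.Icc 0 ((p : ℤ) ^ B)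
  refine ⟨F.sup fun x => s ⟨x.1, x.2⟩, fun t => ?_⟩
  set t' : GaussianInt := ⟨t.re % (p : ℤ) ^ B, t.im % (p : ℤ) ^ B⟩
  refine ⟨s t', ?_, hs1 _, ?_, hs3 _⟩
  · refine Finset.le_sup (f := fun x : ℤ × ℤ => s ⟨x.1, x.2⟩)
      (b := (t.re % (p : ℤ) ^ B, t.im % (p : ℤ) ^ B)) ?_
    simp only [F, Finset.mem_product, Finset.mem_Icc]
    exact ⟨⟨Int.emod_nonneg _ hp0.ne', (Int.emod_lt_of_pos _ hp0).le⟩,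
      ⟨Int.emod_nonneg _ hp0.ne', (Int.emod_lt_of_pos _ hp0).le⟩⟩
  · have h1 : P ^ B ∣ t' - t := by
      have h2 : (((p : ℤ) ^ B : ℤ) : GaussianInt) ∣ t' - t := by
        rw [Zsqrtd.intCast_dvd]
        constructor
        · simp only [t', Zsqrtd.re_sub]
          exact (Int.mod_modEq _ _).symm.dvd
        · simp only [t', Zsqrtd.im_sub]
          exact (Int.mod_modEq _ _).symm.dvd
      refine Dvd.dvd.trans ⟨star P ^ B, ?_⟩ h2
      rw [← mul_pow, h.mul_star]
      push_cast
      rfl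
    have h3 : star Q ^ s t' - (1 + P ^ c * t) * Q ^ s t' =
        (star Q ^ s t' - (1 + P ^ c * t') * Q ^ s t') + P ^ c * Q ^ s t' * (t' - t) := by ring
    rw [h3]
    exact dvd_add (hs2 _) (h1.mul_left _)

/-! ### The torus and the solenoid -/

noncomputable instance : Algebra GaussianInt ℂ := GaussianInt.toComplex.toAlgebra

theorem gaussian_smul (g : GaussianInt) (z : ℂ) : g • z = (g : ℂ) * z := rfl

instance : ContinuousConstSMul GaussianInt ℂ :=
  ⟨fun g => by simp only [gaussian_smul]; fun_prop⟩

/-- The Gaussian integers as a lattice in `ℂ`. -/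
noncomputable def gaussianLattice : Submodule GaussianInt ℂ :=
  LinearMap.range (Algebra.linearMap GaussianInt ℂ)

theorem mem_gaussianLattice {z : ℂ} : z ∈ gaussianLattice ↔ ∃ g : GaussianInt, (g : ℂ) = z :=
  Iff.rfl

instance : IsClosed (gaussianLattice : Set ℂ) := by
  have h : (gaussianLattice : Set ℂ) =
      Complex.re ⁻¹' (Set.range ((↑) : ℤ → ℝ)) ∩ Complex.im ⁻¹' (Set.range ((↑) : ℤ → ℝ)) := by
    ext z
    simp only [SetLike.mem_coe, mem_gaussianLattice, Set.mem_inter_iff, Set.mem_preimage,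
      Set.mem_range]
    constructor
    · rintro ⟨g, rfl⟩
      exact ⟨⟨g.re, by simp⟩, ⟨g.im, by simp⟩⟩
    · rintro ⟨⟨a, ha⟩, ⟨b, hb⟩⟩
      exact ⟨⟨a, b⟩, Complex.ext (by simpa using ha) (by simpa using hb)⟩
  rw [h]
  exact (Int.isClosedEmbedding_coe_real.isClosed_range.preimage Complex.continuous_re).inter
    (Int.isClosedEmbedding_coe_real.isClosed_range.preimage Complex.continuous_im)

/-- The torus `ℂ / ℤ[i]`, as a compact topological module over the Gaussian integers. -/
def Torus : Type := ℂ ⧸ gaussianLattice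

noncomputable instance : AddCommGroup Torus := inferInstanceAs (AddCommGroup (ℂ ⧸ gaussianLattice))
noncomputable instance : Module GaussianInt Torus :=
  inferInstanceAs (Module GaussianInt (ℂ ⧸ gaussianLattice))
noncomputable instance : TopologicalSpace Torus :=
  inferInstanceAs (TopologicalSpace (ℂ ⧸ gaussianLattice))
instance : IsTopologicalAddGroup Torus :=
  inferInstanceAs (IsTopologicalAddGroup (ℂ ⧸ gaussianLattice))
instance : T3Space Torus := inferInstanceAs (T3Space (ℂ ⧸ gaussianLattice))

/-- The projection `ℂ → ℂ / ℤ[i]`. -/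
noncomputable def proj : ℂ →ₗ[GaussianInt] Torus := gaussianLattice.mkQ

theorem continuous_proj : Continuous proj := gaussianLattice.continuous_mkQ

theorem isOpenMap_proj : IsOpenMap proj := gaussianLattice.isOpenMap_mkQ

theorem isQuotientMap_proj : Topology.IsQuotientMap proj := gaussianLattice.isQuotientMap_mkQ

theorem proj_surjective : Function.Surjective proj := gaussianLattice.mkQ_surjective

theorem proj_mul (g : GaussianInt) (z : ℂ) : proj (g * z) = g • proj z := by
  rw [← gaussian_smul, map_smul]

theorem proj_eq_zero {z : ℂ} : proj z = 0 ↔ ∃ g : GaussianInt, (g : ℂ) = z := by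
  rw [← mem_gaussianLattice]
  exact Submodule.Quotient.mk_eq_zero _

theorem proj_eq_iff {z w : ℂ} : proj z = proj w ↔ ∃ g : GaussianInt, z = w + g := by
  rw [← sub_eq_zero, ← map_sub, proj_eq_zero]
  exact exists_congr fun g => by rw [eq_sub_iff_add_eq, eq_comm, add_comm]

theorem exists_gaussianInt_near (z : ℂ) : ∃ g : GaussianInt, ‖z - g‖ ≤ 1 := by
  refine ⟨⟨round z.re, round z.im⟩, (Complex.norm_le_abs_re_add_abs_im _).trans ?_⟩
  have h1 := abs_sub_round z.re
  have h2 := abs_sub_round z.im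
  simp only [Complex.sub_re, Complex.sub_im, GaussianInt.re_toComplex, GaussianInt.im_toComplex]
  linarith

instance : CompactSpace Torus := by
  constructor
  have h : (Set.univ : Set Torus) = proj '' Metric.closedBall 0 1 := by
    refine (Set.eq_univ_of_forall fun t => ?_).symm
    obtain ⟨z, rfl⟩ := proj_surjective t
    obtain ⟨g, hg⟩ := exists_gaussianInt_near z
    exact ⟨z - g, by simpa using hg, proj_eq_iff.mpr ⟨-g, by simp [sub_eq_add_neg]⟩⟩
  rw [h]
  exact (isCompact_closedBall _ _).image continuous_proj

instance : ContinuousConstSMul GaussianInt Torus := by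
  refine ⟨fun g => isQuotientMap_proj.continuous_iff.mpr ?_⟩
  have : ((fun t : Torus => g • t) ∘ proj) = proj ∘ fun z => g • z := by
    ext z; simp
  rw [this]
  exact continuous_proj.comp (continuous_const_smul g)

theorem eq_zero_of_isCoprime_smul {M : Type*} [AddCommGroup M] [Module GaussianInt M]
    {a b : GaussianInt} (h : IsCoprime a b) {v : M} (ha : a • v = 0) (hb : b • v = 0) : v = 0 := by
  obtain ⟨s, t, hst⟩ := h
  rw [← one_smul GaussianInt v, ← hst, add_smul, mul_smul, mul_smul, ha, hb]
  simp

theorem exists_proj_div_eq {a : GaussianInt} (ha : a ≠ 0) {v : Torus} (h : a • v = 0) :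
    ∃ e : GaussianInt, v = proj (e / a) := by
  obtain ⟨z, rfl⟩ := proj_surjective v
  rw [← proj_mul, proj_eq_zero] at h
  obtain ⟨e, he⟩ := h
  refine ⟨e, ?_⟩
  rw [he, mul_div_cancel_left₀]
  simpa using ha

/-- The solenoid: sequences in the torus with `65 • y (l + 1) = y l`. Such a sequence is the same as
a `ℤ[i]`-linear map from `ℤ[i][1 / 65]` to the torus, whose value at `g / 65 ^ l` is `g • y l`; the
solenoid is the Pontryagin dual of `ℤ[i][1 / 65]`. -/
noncomputable def solenoid : AddSubgroup (ℕ → Torus) where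
  carrier := {y | ∀ l, (65 : GaussianInt) • y (l + 1) = y l}
  zero_mem' := fun l => by simp
  add_mem' := fun ha hb l => by simp [ha l, hb l]
  neg_mem' := fun ha l => by simp [ha l]

theorem isClosed_solenoid : IsClosed (solenoid : Set (ℕ → Torus)) := by
  have : (solenoid : Set (ℕ → Torus)) = ⋂ l, {y | (65 : GaussianInt) • y (l + 1) = y l} := by
    ext y; simp [solenoid]
  rw [this]
  exact isClosed_iInter fun l =>
    isClosed_eq ((continuous_const_smul (65 : GaussianInt)).comp (continuous_apply (l + 1)))
      (continuous_apply l)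

theorem solenoid_pow_smul {y : ℕ → Torus} (hy : y ∈ solenoid) (l j : ℕ) :
    (65 : GaussianInt) ^ j • y (l + j) = y l := by
  induction j with
  | zero => simp
  | succ j ih => rw [pow_succ, mul_smul, ← add_assoc, hy (l + j), ih]

theorem solenoid_eq_zero_of_le {y : ℕ → Torus} (hy : y ∈ solenoid) {l j : ℕ} (h : y l = 0)
    (hj : j ≤ l) : y j = 0 := by
  obtain ⟨i, rfl⟩ := Nat.exists_eq_add_of_le hj
  rw [← solenoid_pow_smul hy j i, h, smul_zero]

/-- Multiplication by the number `g / 65 ^ k` on the solenoid, written as a map on all sequences. -/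
noncomputable def scale (g : GaussianInt) (k : ℕ) : (ℕ → Torus) →+ (ℕ → Torus) where
  toFun y := fun l => g • y (l + k)
  map_zero' := by ext; simp
  map_add' _ _ := by ext; simp

theorem scale_apply (g : GaussianInt) (k : ℕ) (y : ℕ → Torus) (l : ℕ) :
    scale g k y l = g • y (l + k) := rfl

theorem continuous_scale (g : GaussianInt) (k : ℕ) : Continuous (scale g k) :=
  continuous_pi fun l => (continuous_const_smul g).comp (continuous_apply (l + k))

theorem scale_scale (g h : GaussianInt) (k j : ℕ) (y : ℕ → Torus) :
    scale g k (scale h j y) = scale (g * h) (k + j) y := by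
  ext l
  rw [scale_apply, scale_apply, scale_apply, mul_smul, add_assoc]

theorem scale_mem {y : ℕ → Torus} (hy : y ∈ solenoid) (g : GaussianInt) (k : ℕ) :
    scale g k y ∈ solenoid := by
  intro l
  rw [scale_apply, scale_apply, smul_comm, show l + 1 + k = l + k + 1 by ring, hy]

theorem scale_pow_self {y : ℕ → Torus} (hy : y ∈ solenoid) (k : ℕ) : scale (65 ^ k) k y = y := by
  ext l
  rw [scale_apply, solenoid_pow_smul hy]

theorem toComplex_sixtyFive : ((65 : GaussianInt) : ℂ) = 65 := map_ofNat GaussianInt.toComplex 65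

theorem toComplex_pow (g : GaussianInt) (k : ℕ) : ((g ^ k : GaussianInt) : ℂ) = (g : ℂ) ^ k :=
  map_pow GaussianInt.toComplex g k

/-- The homomorphism from `ℂ` to the solenoid that sends `z` to multiplication by `z`. Its image is
a dense leaf, and the rotations act on it by honest rotation of `ℂ`. -/
noncomputable def line : ℂ →+ (ℕ → Torus) where
  toFun z := fun l => proj (z / 65 ^ l)
  map_zero' := by ext; simp
  map_add' _ _ := by ext; simp [add_div]

theorem line_apply (z : ℂ) (l : ℕ) : line z l = proj (z / 65 ^ l) := rfl

theorem line_mem (z : ℂ) : line z ∈ solenoid := by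
  intro l
  rw [line_apply, line_apply, ← proj_mul, toComplex_sixtyFive, pow_succ]
  congr 1
  field_simp

theorem scale_line (g : GaussianInt) (k : ℕ) (z : ℂ) :
    scale g k (line z) = line (g / 65 ^ k * z) := by
  ext l
  rw [scale_apply, line_apply, line_apply, ← proj_mul, pow_add]
  congr 1
  field_simp

theorem one_le_norm_gaussianInt {g : GaussianInt} (hg : g ≠ 0) : 1 ≤ ‖(g : ℂ)‖ := by
  have h1 : (1 : ℤ) ≤ g.norm := GaussianInt.norm_pos.mpr hg
  have h2 : (1 : ℝ) ≤ ‖(g : ℂ)‖ ^ 2 := by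
    rw [← Complex.normSq_eq_norm_sq, ← GaussianInt.intCast_real_norm]
    exact_mod_cast h1
  nlinarith [norm_nonneg (g : ℂ)]

theorem line_injective : Function.Injective line := by
  refine (injective_iff_map_eq_zero _).mpr fun z hz => ?_
  by_contra hne
  obtain ⟨l, hl⟩ := pow_unbounded_of_one_lt ‖z‖ (by norm_num : (1 : ℝ) < 65)
  obtain ⟨g, hg⟩ := proj_eq_zero.mp (congrFun hz l)
  have hg0 : g ≠ 0 := by
    rintro rfl
    rw [GaussianInt.toComplex_zero, eq_comm, div_eq_zero_iff] at hg
    exact hg.elim hne (pow_ne_zero _ (by norm_num))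
  have := one_le_norm_gaussianInt hg0
  rw [hg, norm_div, norm_pow, Complex.norm_ofNat, one_le_div (by positivity)] at this
  linarith

/-- Local product structure: a point of the solenoid is the sum of a point of the complex leaf and of
a point `κ` of the totally disconnected direction, with `κ` trivial at the level `l`. -/
theorem exists_line_add {y : ℕ → Torus} (hy : y ∈ solenoid) {l : ℕ} {w : ℂ}
    (h : y l = proj w) : ∃ κ ∈ solenoid, κ l = 0 ∧ y = line (65 ^ l * w) + κ := by
  refine ⟨y - line (65 ^ l * w), sub_mem hy (line_mem _), ?_, by abel⟩
  rw [Pi.sub_apply, h, line_apply, mul_div_cancel_left₀ _ (pow_ne_zero _ (by norm_num)), sub_self]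

theorem isOpen_setOf_apply_mem_proj_ball (x : ℕ → Torus) (l : ℕ) (r : ℝ) :
    IsOpen {y : ℕ → Torus | y l - x l ∈ proj '' Metric.ball 0 r} :=
  (isOpenMap_proj _ Metric.isOpen_ball).preimage
    ((continuous_apply l).sub continuous_const)

/-- A point of the solenoid lies in a closed set as soon as the set comes close to it at each
single level: closeness at the level `l` forces closeness at all lower levels. -/
theorem mem_of_forall_apply_near {Y : Set (ℕ → Torus)} (hY : IsClosed Y)
    (hYs : Y ⊆ solenoid) {x : ℕ → Torus} (hx : x ∈ solenoid)
    (h : ∀ (l : ℕ) (r : ℝ), 0 < r → ∃ y ∈ Y, y l - x l ∈ proj '' Metric.ball 0 r) : x ∈ Y := by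
  rw [← hY.closure_eq, mem_closure_iff_nhds]
  intro U hU
  rw [nhds_pi, Filter.mem_pi] at hU
  obtain ⟨I, hI, V, hV, hVU⟩ := hU
  obtain ⟨L, hL⟩ := hI.bddAbove
  have hmem : ∀ i ≤ L, {w : ℂ | x i + (65 : GaussianInt) ^ (L - i) • proj w ∈ V i} ∈
      nhds (0 : ℂ) := by
    intro i _
    have hc : Continuous fun w : ℂ => x i + (65 : GaussianInt) ^ (L - i) • proj w :=
      continuous_const.add ((continuous_const_smul _).comp continuous_proj)
    apply hc.continuousAt
    simpa using hV i
  have hfin : (⋂ i ∈ Finset.range (L + 1),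
      {w : ℂ | x i + (65 : GaussianInt) ^ (L - i) • proj w ∈ V i}) ∈ nhds (0 : ℂ) :=
    (Filter.biInter_finset_mem _).mpr fun i hi =>
      hmem i (by simpa [Nat.lt_succ_iff] using hi)
  obtain ⟨r, hr, hball⟩ := Metric.mem_nhds_iff.mp hfin
  obtain ⟨y, hy, w, hw, hyw⟩ := h L r hr
  refine ⟨y, hVU fun i hi => ?_, hy⟩
  have h1 := Set.mem_iInter₂.mp (hball hw) i (by simpa [Nat.lt_succ_iff] using hL hi)
  have h2 : y i - x i = (65 : GaussianInt) ^ (L - i) • proj w := by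
    have := solenoid_pow_smul (sub_mem (hYs hy) hx) i (L - i)
    rw [Nat.add_sub_cancel' (hL hi), Pi.sub_apply, ← hyw] at this
    rw [this, Pi.sub_apply]
  rw [Set.mem_ofPred_eq, ← h2, add_sub_cancel] at h1
  exact h1

/-! ### The four places and the action of the rotations -/

/-- The four places of `ℚ(i)` above `5` and `13`. -/
inductive Place
  | five
  | fiveBar
  | thirteen
  | thirteenBar

namespace Place

/-- The Gaussian prime of a place. -/
def prime : Place → GaussianInt
  | five => P5
  | fiveBar => star P5
  | thirteen => P13
  | thirteenBar => star P13

/-- A place above the other rational prime. -/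
def other : Place → Place
  | five => thirteen
  | fiveBar => thirteen
  | thirteen => five
  | thirteenBar => five

/-- The conjugate place. -/
def bar : Place → Place
  | five => fiveBar
  | fiveBar => five
  | thirteen => thirteenBar
  | thirteenBar => thirteen

theorem exists_isPlace (v : Place) : ∃ p, IsPlace v.prime v.other.prime p := by
  cases v
  · exact ⟨5, isPlace_five (Or.inl rfl) (Or.inl rfl)⟩
  · exact ⟨5, isPlace_five (Or.inr rfl) (Or.inl rfl)⟩
  · exact ⟨13, isPlace_thirteen (Or.inl rfl) (Or.inl rfl)⟩
  · exact ⟨13, isPlace_thirteen (Or.inr rfl) (Or.inl rfl)⟩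

/-- The numerator of `star P / P` over the denominator `65`, where `P` is the prime of the place. -/
def num (v : Place) : GaussianInt :=
  v.other.prime * star v.other.prime * star v.prime ^ 2

theorem num_other (v : Place) : v.other.num = v.prime * star v.prime * star v.other.prime ^ 2 := by
  cases v <;> decide

theorem num_bar_mul (v : Place) : v.bar.num * v.num = 65 ^ 2 := by
  cases v <;> decide

theorem prime_ne_zero (v : Place) : v.prime ≠ 0 := v.exists_isPlace.choose_spec.prime.ne_zero

/-- The unit complex number `star P / P`, where `P` is the prime of the place. It is `θ₅` or `θ₁₃` at
the conjugate places, and the inverse of one of these at the other two. -/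
noncomputable def rot (v : Place) : ℂ := rotation v.prime

theorem norm_rot (v : Place) : ‖v.rot‖ = 1 := norm_rotation v.prime_ne_zero

theorem num_div (v : Place) : (v.num : ℂ) / 65 = v.rot := by
  obtain ⟨p, h⟩ := v.exists_isPlace
  have h0 : (v.prime : ℂ) ≠ 0 := by simpa using v.prime_ne_zero
  have h1 : (v.num : ℂ) * v.prime = 65 * (star v.prime : GaussianInt) := by
    rw [← toComplex_sixtyFive, ← map_mul, ← map_mul, ← h.mul_eq]
    congr 1
    simp only [num]; ring
  rw [rot, rotation, div_eq_div_iff (by norm_num) h0, h1, mul_comm]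

/-- Multiplication by `rot v ^ m` on the solenoid. -/
noncomputable def op (v : Place) (m : ℕ) : (ℕ → Torus) →+ (ℕ → Torus) := scale (v.num ^ m) m

theorem op_line (v : Place) (m : ℕ) (z : ℂ) : v.op m (line z) = line (v.rot ^ m * z) := by
  rw [op, scale_line, ← num_div, div_pow, toComplex_pow]

theorem op_op (v : Place) (m n : ℕ) (y : ℕ → Torus) : v.op m (v.op n y) = v.op (m + n) y := by
  rw [op, op, op, scale_scale, pow_add]

theorem op_comm (v w : Place) (m n : ℕ) (y : ℕ → Torus) :
    v.op m (w.op n y) = w.op n (v.op m y) := by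
  rw [op, op, scale_scale, scale_scale, mul_comm, add_comm]

theorem op_zero (v : Place) (y : ℕ → Torus) : v.op 0 y = y := by
  ext l; simp [op, scale_apply]

theorem op_mem (v : Place) (m : ℕ) {y : ℕ → Torus} (hy : y ∈ solenoid) : v.op m y ∈ solenoid :=
  scale_mem hy _ _

theorem op_bar_op (v : Place) (m : ℕ) {y : ℕ → Torus} (hy : y ∈ solenoid) :
    v.bar.op m (v.op m y) = y := by
  rw [op, op, scale_scale, ← mul_pow, num_bar_mul, ← pow_mul, ← two_mul, scale_pow_self hy]

theorem continuous_op (v : Place) (m : ℕ) : Continuous (v.op m) := continuous_scale _ _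

end Place

/-! ### Transversal accumulation at the complex leaf -/

/-- A set of points of the solenoid that is stable under the `m`-th powers of the four rotations
`θ₅`, `θ₅⁻¹`, `θ₁₃`, `θ₁₃⁻¹`. -/
def Invariant (m : ℕ) (Y : Set (ℕ → Torus)) : Prop := ∀ v : Place, ∀ y ∈ Y, v.op m y ∈ Y

theorem Invariant.of_dvd {m n : ℕ} {Y : Set (ℕ → Torus)} (h : Invariant m Y) (hmn : m ∣ n) :
    Invariant n Y := by
  obtain ⟨k, rfl⟩ := hmn
  intro v y hy
  induction k with
  | zero => simpa [Place.op_zero] using hy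
  | succ k ih =>
    rw [mul_add, mul_one, add_comm, ← Place.op_op]
    exact h v _ ih

/-- The set `Y` accumulates at `x` transversally to the complex leaf: there are points of `Y`
arbitrarily close to `x` whose local displacement has a nonzero component `κ` in the totally
disconnected direction. -/
def Accumulates (Y : Set (ℕ → Torus)) (x : ℕ → Torus) : Prop :=
  ∀ (l : ℕ) (δ : ℝ), 0 < δ → ∃ (z : ℂ) (κ : ℕ → Torus), ‖z‖ < δ ∧ κ ∈ solenoid ∧ κ l = 0 ∧
    κ ≠ 0 ∧ x + line z + κ ∈ Y

/-- A nonzero point of the solenoid is nonzero at `P⁻ⁿ` for some `n` and some place `P` above `5` or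
`13`. The number `P⁻ⁿ` is written over the denominator `65 ^ n`. -/
theorem exists_component_ne_zero {κ : ℕ → Torus} (hκ : κ ≠ 0) :
    ∃ (v : Place) (n : ℕ),
      (v.other.prime * star v.other.prime * star v.prime) ^ n • κ n ≠ 0 := by
  by_contra! hall
  apply hκ
  ext n
  have h5 : IsCoprime P5 (star P5) := (isPlace_five (Or.inl rfl) (Or.inl rfl)).coprime_star
  have h13 : IsCoprime P13 (star P13) := (isPlace_thirteen (Or.inl rfl) (Or.inl rfl)).coprime_star
  have hP5 : P5 * star P5 = 5 := by decide
  have hP13 : P13 * star P13 = 13 := by decide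
  have e1 := hall .five n
  have e2 := hall .fiveBar n
  have e3 := hall .thirteen n
  have e4 := hall .thirteenBar n
  simp only [Place.other, Place.prime, star_star, hP5, hP13, mul_pow] at e1 e2 e3 e4
  rw [mul_comm, mul_smul] at e1 e2 e3 e4
  have f1 := eq_zero_of_isCoprime_smul (h5.pow (m := n) (n := n)) e2 e1
  have f2 := eq_zero_of_isCoprime_smul (h13.pow (m := n) (n := n)) e4 e3
  have hc : IsCoprime (13 : GaussianInt) 5 := ⟨2, -5, by decide⟩
  exact eq_zero_of_isCoprime_smul (hc.pow (m := n) (n := n)) f1 f2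

/-- Transversal accumulation happens at one fixed place. -/
theorem Accumulates.exists_place {Y : Set (ℕ → Torus)} {x : ℕ → Torus} (h : Accumulates Y x) :
    ∃ v : Place, ∀ (l : ℕ) (δ : ℝ), 0 < δ → ∃ (z : ℂ) (κ : ℕ → Torus), ‖z‖ < δ ∧ κ ∈ solenoid ∧
      κ l = 0 ∧ (∃ n, (v.other.prime * star v.other.prime * star v.prime) ^ n • κ n ≠ 0) ∧
      x + line z + κ ∈ Y := by
  by_contra! hall
  choose l δ hδ hbad using hall
  obtain ⟨z, κ, hz, hκ, hκl, hκ0, hY⟩ := h (l .five + l .fiveBar + l .thirteen + l .thirteenBar)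
    (min (min (δ .five) (δ .fiveBar)) (min (δ .thirteen) (δ .thirteenBar)))
    (by simp [hδ])
  obtain ⟨v, n, hn⟩ := exists_component_ne_zero hκ0
  refine hbad v z κ ?_ hκ ?_ ⟨n, hn⟩ hY
  · simp only [lt_min_iff] at hz
    cases v <;> tauto
  · refine solenoid_eq_zero_of_le hκ hκl ?_
    cases v <;> omega

/-! The next three lemmas follow a totally disconnected component `κ` whose last trivial value in the
direction `P` is the one at `P⁻ᵃ`, while it is multiplied by `(star P / P) ^ M * (star Q / Q) ^ s` and
evaluated at `65⁻ʲ`. The variables `Pb` and `Qb` stand for the conjugates of `P` and `Q`. -/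

section LocalComponent

variable {P Q Pb Qb : GaussianInt} {κ : ℕ → Torus} {a b j M : ℕ}

/-- The rotation by `star Q / Q` acts on the component at the level `j` by this same number. -/
theorem smul_component_comm (hpq : P * Pb * (Q * Qb) = 65) (hκ : κ ∈ solenoid) (s : ℕ) :
    Q ^ s • (((P * Pb * Qb ^ 2) ^ s * (Q * Qb * Pb ^ 2) ^ M) • κ (j + (s + M))) =
      Qb ^ s • ((Q * Qb * Pb ^ 2) ^ M • κ (j + M)) := by
  rw [← solenoid_pow_smul hκ (j + M) s, show j + M + s = j + (s + M) by ring, ← hpq]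
  simp only [smul_smul]
  congr 1
  ring

/-- After the expansion, the component at the level `j` is `P`-power torsion: the parts at the other
places have become trivial at this level. -/
theorem pow_smul_component (hpq : P * Pb * (Q * Qb) = 65) (hκ : κ ∈ solenoid)
    (hcop : IsCoprime P (Q * Qb)) {s l : ℕ} (hl : κ l = 0) (hjs : j + s ≤ l)
    (ha : (Q * Qb * Pb) ^ a • κ a = 0) (hab : M + j = a + b) (hjM : j ≤ M) :
    P ^ b • (((P * Pb * Qb ^ 2) ^ s * (Q * Qb * Pb ^ 2) ^ M) • κ (j + (s + M))) = 0 := by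
  refine eq_zero_of_isCoprime_smul (hcop.pow (m := a) (n := j + s)) ?_ ?_
  · have h1 : (65 : GaussianInt) ^ M • κ (j + (s + M)) = 0 := by
      rw [← add_assoc, solenoid_pow_smul hκ (j + s) M]
      exact solenoid_eq_zero_of_le hκ hl hjs
    have h2 : P ^ a * (P ^ b * ((P * Pb * Qb ^ 2) ^ s * (Q * Qb * Pb ^ 2) ^ M)) =
        (P ^ j * (P * Pb * Qb ^ 2) ^ s * Pb ^ M) * 65 ^ M := by
      rw [← mul_assoc, ← pow_add, ← hab, ← hpq]
      ring
    rw [smul_smul, smul_smul, mul_assoc, h2, mul_smul, h1, smul_zero]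
  · have h1 := solenoid_pow_smul hκ a (b + s)
    obtain ⟨d, rfl⟩ := Nat.exists_eq_add_of_le hjM
    rw [show a + (b + s) = j + (s + (j + d)) by omega] at h1
    have h2 : (Q * Qb) ^ (j + s) * (P ^ b *
        ((P * Pb * Qb ^ 2) ^ s * (Q * Qb * Pb ^ 2) ^ (j + d))) =
        (Pb ^ d * Qb ^ (2 * s)) * ((Q * Qb * Pb) ^ a * 65 ^ (b + s)) := by
      rw [← hpq, show (Q * Qb * Pb) ^ a * (P * Pb * (Q * Qb)) ^ (b + s) =
        (Q * Qb * Pb) ^ (a + b) * ((Q * Qb * Pb) ^ s * P ^ (b + s)) by ring, ← hab]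
      ring
    rw [smul_smul, smul_smul, mul_assoc, h2, mul_smul, mul_smul _ (65 ^ (b + s)), h1, ha,
      smul_zero]

/-- The order of the component at the level `j` is exactly the expected power of `P`. -/
theorem pow_smul_component_ne_zero (hpq : P * Pb * (Q * Qb) = 65) (hκ : κ ∈ solenoid)
    (hcop : IsCoprime P Pb) (ha : (Q * Qb * Pb) ^ a • κ a = 0)
    (ha1 : (Q * Qb * Pb) ^ (a + 1) • κ (a + 1) ≠ 0) (hab : M + j = a + (b + 1)) (hjM : j ≤ M) :
    P ^ b • ((Q * Qb * Pb ^ 2) ^ M • κ (j + M)) ≠ 0 := by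
  intro h0
  obtain ⟨d, rfl⟩ := Nat.exists_eq_add_of_le hjM
  refine ha1 (eq_zero_of_isCoprime_smul (hcop.pow_right (n := d)) ?_ ?_)
  · rw [← ha, ← hκ a, smul_smul, smul_smul, ← hpq]
    congr 1
    ring
  · have h1 := solenoid_pow_smul hκ (a + 1) b
    rw [show a + 1 + b = j + (j + d) by omega] at h1
    have h2 : Pb ^ d * ((Q * Qb * Pb) ^ (a + 1) * 65 ^ b) =
        (Q * Qb) ^ j * (P ^ b * (Q * Qb * Pb ^ 2) ^ (j + d)) := by
      rw [← hpq, show (Q * Qb * Pb) ^ (a + 1) * (P * Pb * (Q * Qb)) ^ b =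
        (Q * Qb * Pb) ^ (a + (b + 1)) * P ^ b by ring, ← hab]
      ring
    rw [← h1, smul_smul, smul_smul, mul_assoc, h2, mul_smul, mul_smul, h0, smul_zero]

end LocalComponent

theorem one_lt_norm_of_prime {P : GaussianInt} (hP : Prime P) : 1 < ‖(P : ℂ)‖ := by
  refine lt_of_le_of_ne (one_le_norm_gaussianInt hP.ne_zero) fun h => hP.not_isUnit ?_
  rw [← Zsqrtd.norm_eq_one_iff' (by norm_num)]
  have h1 : (P.norm : ℝ) = 1 := by
    rw [GaussianInt.intCast_real_norm, Complex.normSq_eq_norm_sq, ← h, one_pow]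
  exact_mod_cast h1

theorem exists_multiple_between {m : ℕ} (hm : 0 < m) (A : ℕ) : ∃ M, m ∣ M ∧ A ≤ M ∧ M < A + m := by
  refine ⟨m * ((A + m - 1) / m), dvd_mul_right _ _, ?_, ?_⟩
  · have := Nat.div_add_mod (A + m - 1) m
    have := Nat.mod_lt (A + m - 1) hm
    omega
  · have := Nat.mul_div_le (A + m - 1) m
    omega

/-- A set that is invariant and accumulates at the complex leaf transversally comes close, at each
level, to every point. Expanding by `star P / P` makes the displacement a torsion element of order
exactly `P ^ (b + 1)`; the rotations by `star Q / Q` then multiply it by arbitrary elements of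
`1 + P ^ c ℤ[i]` while hardly moving the complex component, and the multiples so obtained form a
translate of a lattice of mesh `‖P‖ ^ (c - b - 1)`. -/
theorem exists_mem_apply_near {Y : Set (ℕ → Torus)} {m : ℕ} (hm : 0 < m) (hY : Invariant m Y)
    {z₀ : ℂ} (hacc : Accumulates Y (line z₀)) (j : ℕ) (w₀ : ℂ) {δ : ℝ} (hδ : 0 < δ) :
    ∃ y ∈ Y, y j - proj w₀ ∈ proj '' Metric.ball 0 δ := by
  obtain ⟨v, hv⟩ := hacc.exists_place
  obtain ⟨p, hp⟩ := v.exists_isPlace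
  set P := v.prime with hPdef
  set Q := v.other.prime with hQdef
  obtain ⟨c, hc⟩ := hp.exists_pow_congr_near hm
  have hP1 := one_lt_norm_of_prime hp.prime
  have hP0 : (P : ℂ) ≠ 0 := by rw [← norm_pos_iff]; linarith
  obtain ⟨d, hd⟩ := pow_unbounded_of_one_lt (2 / δ) hP1
  -- The rotation must displace the complex component, of norm at most `‖z₀‖ + 1`, by at most `δ / 2`.
  set η : ℝ := δ / (2 * (‖z₀‖ + 2)) with hη
  have hz₀ : 0 ≤ ‖z₀‖ := norm_nonneg _
  have hη0 : 0 < η := by positivity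
  obtain ⟨S, hS⟩ := hc (c + d + 1 + m) η hη0
  obtain ⟨z', κ, hz', hκ, hκl, hne, hmem⟩ := hv (S + 2 * j) 1 one_pos
  classical
  obtain ⟨a, ha, ha1, hla⟩ : ∃ a, (Q * star Q * star P) ^ a • κ a = 0 ∧
      (Q * star Q * star P) ^ (a + 1) • κ (a + 1) ≠ 0 ∧ S + 2 * j ≤ a := by
    have hlow : S + 2 * j < Nat.find hne := by
      by_contra! hle
      exact Nat.find_spec hne (by rw [solenoid_eq_zero_of_le hκ hκl hle, smul_zero])
    refine ⟨Nat.find hne - 1, ?_, ?_, by omega⟩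
    · have := Nat.find_min hne (m := Nat.find hne - 1) (by omega)
      simpa using this
    · rw [Nat.sub_add_cancel (by omega)]
      exact Nat.find_spec hne
  -- The exponent `M` of the expansion is chosen so that the resulting torsion element has order
  -- `P ^ (b + 1)` with `b + 1 = M + j - a` between `c + d + 1` and `c + d + 1 + m`.
  obtain ⟨M, hmM, hM1, hM2⟩ := exists_multiple_between hm (a + (c + d + 1) - j)
  obtain ⟨b, hb⟩ : ∃ b, M + j = a + (b + 1) := ⟨M + j - a - 1, by omega⟩
  have hbc : c + d ≤ b := by omega
  have hbB : b + 1 ≤ c + d + 1 + m := by omega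
  have hjM : j ≤ M := by omega
  obtain ⟨F, hF⟩ : ∃ F : ℕ → Torus, ∀ s, F s =
      ((P * star P * star Q ^ 2) ^ s * (Q * star Q * star P ^ 2) ^ M) • κ (j + (s + M)) :=
    ⟨_, fun _ => rfl⟩
  have hF0 : F 0 = (Q * star Q * star P ^ 2) ^ M • κ (j + M) := by simp [hF]
  have hFb : ∀ s ≤ S, P ^ (b + 1) • F s = 0 := fun s hs => by
    rw [hF]
    exact pow_smul_component hp.mul_eq hκ (hp.coprime_left.mul_right hp.coprime_right) hκl
      (by omega) ha hb hjM
  obtain ⟨e, he⟩ := exists_proj_div_eq (pow_ne_zero (b + 1) hp.prime.ne_zero) (hFb 0 (Nat.zero_le _))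
  have hPe : ¬ P ∣ e := by
    rintro ⟨e', rfl⟩
    apply pow_smul_component_ne_zero hp.mul_eq hκ hp.coprime_star ha ha1 hb hjM
    rw [← hF0, he, ← proj_mul, proj_eq_zero]
    refine ⟨e', ?_⟩
    rw [map_mul, toComplex_pow, toComplex_pow]
    field_simp
    ring
  have hFs : ∀ (t : GaussianInt), ∀ s ≤ S,
      P ^ (c + d + 1 + m) ∣ star Q ^ s - (1 + P ^ c * t) * Q ^ s →
      F s = (1 + P ^ c * t) • F 0 := by
    intro t s hs hdvd
    rw [← sub_eq_zero]
    refine eq_zero_of_isCoprime_smul (hp.coprime_left.pow (m := b + 1) (n := s)) ?_ ?_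
    · rw [smul_sub, hFb s hs, smul_comm, hFb 0 (Nat.zero_le _), smul_zero, sub_zero]
    · have h1 : Q ^ s • F s = star Q ^ s • F 0 := by
        rw [hF, hF0]; exact smul_component_comm hp.mul_eq hκ s
      obtain ⟨g, hg⟩ := (pow_dvd_pow P hbB).trans hdvd
      rw [smul_sub, h1, smul_smul, ← sub_smul, mul_comm (Q ^ s), hg, mul_comm, mul_smul,
        hFb 0 (Nat.zero_le _), smul_zero]
  set w₁ : ℂ := v.rot ^ M * (z₀ + z') / 65 ^ j with hw₁
  have hw₁n : ‖w₁‖ ≤ ‖z₀‖ + 1 := by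
    rw [hw₁, norm_div, norm_mul, norm_pow, v.norm_rot, one_pow, one_mul, norm_pow,
      Complex.norm_ofNat]
    refine (div_le_self (norm_nonneg _) (one_le_pow₀ (by norm_num))).trans ?_
    exact (norm_add_le _ _).trans (by linarith)
  obtain ⟨n, hn⟩ : ∃ n, b + 1 = c + n := ⟨b + 1 - c, by omega⟩
  have hdn : d ≤ n := by omega
  -- The lattice point `g / P ^ n` to be added to the displaced point in order to reach `w₀`.
  obtain ⟨g, hg⟩ := exists_gaussianInt_near ((P : ℂ) ^ n * (w₀ - w₁ - e / P ^ (b + 1)))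
  have hcop : IsCoprime e (P ^ n) :=
    (hp.prime.irreducible.coprime_iff_not_dvd.mpr hPe).symm.pow_right
  obtain ⟨t₁, t₂, ht⟩ := hcop
  obtain ⟨s, hsS, hms, hcong, hnear⟩ := hS (t₁ * g)
  have hfs := hFs (t₁ * g) s hsS hcong
  refine ⟨v.other.op s (v.op M (line z₀ + line z' + κ)),
    (hY.of_dvd hms) _ _ ((hY.of_dvd hmM) _ _ hmem), ?_⟩
  have hval : v.other.op s (v.op M (line z₀ + line z' + κ)) j =
      proj (v.other.rot ^ s * w₁) + F s := by
    rw [← map_add, map_add, map_add, Place.op_line, Place.op_line, Pi.add_apply, line_apply]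
    congr 1
    · congr 1
      rw [hw₁]; ring
    · rw [Place.op, Place.op, scale_scale, scale_apply, Place.num_other, hF]
      rfl
  have hT : ((t₁ : ℂ) * e + t₂ * P ^ n) = 1 := by
    rw [← toComplex_pow, ← map_mul, ← map_mul, ← map_add, ht, map_one]
  refine ⟨(v.other.rot ^ s - 1) * w₁ +
    (w₁ + e / P ^ (b + 1) + g / P ^ n - w₀), ?_, ?_⟩
  · rw [mem_ball_zero_iff]
    have h1 : ‖(v.other.rot ^ s - 1) * w₁‖ ≤ δ / 2 := by
      rw [norm_mul]
      calc ‖v.other.rot ^ s - 1‖ * ‖w₁‖ ≤ η * (‖z₀‖ + 2) :=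
            mul_le_mul hnear.le (hw₁n.trans (by linarith)) (norm_nonneg _) hη0.le
        _ = δ / 2 := by rw [hη]; field_simp
    have h2 : ‖w₁ + e / P ^ (b + 1) + g / P ^ n - w₀‖ < δ / 2 := by
      have h3 : w₁ + e / P ^ (b + 1) + g / P ^ n - w₀ =
          -(((P : ℂ) ^ n * (w₀ - w₁ - e / P ^ (b + 1)) - g) / P ^ n) := by
        field_simp
        ring
      have h4 : 2 / δ < ‖(P : ℂ)‖ ^ n := hd.trans_le (pow_le_pow_right₀ hP1.le hdn)
      have h5 : 0 < ‖(P : ℂ)‖ ^ n := lt_trans (by positivity) h4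
      rw [h3, norm_neg, norm_div, norm_pow, div_lt_iff₀ h5]
      rw [div_lt_iff₀ hδ] at h4
      linarith
    exact (norm_add_le _ _).trans_lt (by linarith)
  · rw [hval, hfs, he, ← proj_mul, ← map_add, ← map_sub, proj_eq_iff]
    refine ⟨t₂ * g, ?_⟩
    simp only [map_add, map_mul, map_one, toComplex_pow]
    rw [hn, pow_add]
    field_simp
    linear_combination (-(g : ℂ) * P ^ c) * hT

/-- A closed invariant set that accumulates at a point of the complex leaf transversally is the whole
solenoid. -/
theorem solenoid_subset_of_accumulates {Y : Set (ℕ → Torus)} {m : ℕ} (hm : 0 < m)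
    (hYc : IsClosed Y) (hYs : Y ⊆ solenoid) (hY : Invariant m Y) {z₀ : ℂ}
    (hacc : Accumulates Y (line z₀)) : (solenoid : Set (ℕ → Torus)) ⊆ Y := by
  intro x hx
  refine mem_of_forall_apply_near hYc hYs hx fun l r hr => ?_
  obtain ⟨w₀, hw₀⟩ := proj_surjective (x l)
  rw [← hw₀]
  exact exists_mem_apply_near hm hY hacc l w₀ hr

/-! ### Invariant sets that avoid the stripe -/

/-- The set is contained in finitely many translates of the complex leaf. -/
def MeetsFinitelyManyLeaves (X : Set (ℕ → Torus)) : Prop :=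
  ∃ F : Set (ℕ → Torus), F.Finite ∧ ∀ x ∈ X, ∃ f ∈ F, ∃ z : ℂ, x = f + line z

theorem meetsFinitelyManyLeaves_of_not_accumulates {X : Set (ℕ → Torus)} (hX : IsClosed X)
    (hXs : X ⊆ solenoid) (h : ∀ x ∈ X, ¬ Accumulates X x) : MeetsFinitelyManyLeaves X := by
  simp only [Accumulates, not_forall, not_exists, not_and] at h
  choose! l δ hδ hbad using h
  obtain ⟨t, ht, htX⟩ := hX.isCompact.elim_nhds_subcover
    (fun x => {y : ℕ → Torus | y (l x) - x (l x) ∈ proj '' Metric.ball 0 (δ x / 65 ^ l x)})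
    (fun x hx => (isOpen_setOf_apply_mem_proj_ball x _ _).mem_nhds
      ⟨0, Metric.mem_ball_self (div_pos (hδ x hx) (pow_pos (by norm_num) _)), by simp⟩)
  refine ⟨t, t.finite_toSet, fun y hy => ?_⟩
  obtain ⟨x, hxt, w, hw, hwy⟩ := Set.mem_iUnion₂.mp (htX hy)
  refine ⟨x, hxt, 65 ^ l x * w, ?_⟩
  obtain ⟨κ, hκ, hκl, hyx⟩ :=
    exists_line_add (sub_mem (hXs hy) (hXs (ht x hxt))) (l := l x) (w := w) hwy.symm
  have hκ0 : κ = 0 := by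
    by_contra hne
    refine hbad x (ht x hxt) (65 ^ l x * w) κ ?_ hκ hκl hne ?_
    · rw [mem_ball_zero_iff, lt_div_iff₀ (by positivity)] at hw
      rw [norm_mul, norm_pow, Complex.norm_ofNat]
      linarith
    · rwa [add_assoc, ← hyx, add_sub_cancel]
  rw [hκ0, add_zero] at hyx
  rw [← hyx, add_sub_cancel]

theorem Place.rot_pow_ne_one (v : Place) {m : ℕ} (hm : 0 < m) : v.rot ^ m ≠ 1 := by
  have h : IsCoprime v.prime (star v.prime) := v.exists_isPlace.choose_spec.coprime_star
  exact rotation_pow_ne_one h v.exists_isPlace.choose_spec.prime.not_isUnit hm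

/-- The rotations permute the finitely many leaves that meet an invariant set, so that a common power
of them fixes each leaf; each of its points is then, up to a translation along the leaf, a fixed
point of that power. -/
theorem exists_fixed_of_meetsFinitelyManyLeaves {X : Set (ℕ → Torus)} {m : ℕ} (hm : 0 < m)
    (hXs : X ⊆ solenoid) (hX : Invariant m X) (hfin : MeetsFinitelyManyLeaves X) :
    ∃ n : ℕ, 0 < n ∧ m ∣ n ∧ ∀ x ∈ X, ∃ z : ℂ, ∀ v : Place,
      v.op n (x - line z) = x - line z := by
  obtain ⟨F, hF, hcov⟩ := hfin
  set N := hF.toFinset.card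
  have hn : 0 < m * N.factorial := Nat.mul_pos hm N.factorial_pos
  refine ⟨m * N.factorial, hn, dvd_mul_right _ _, fun x hx => ?_⟩
  have hleaf : ∀ v : Place, ∃ u : ℂ, v.op (m * N.factorial) x - x = line u := by
    intro v
    choose f hf z hz using fun i : ℕ => hcov _ (hX.of_dvd (dvd_mul_right m i) v x hx)
    obtain ⟨i, hi, j, hj, hij, hfij⟩ := Finset.exists_ne_map_eq_of_card_lt_of_maps_to
      (s := Finset.range (N + 1)) (t := hF.toFinset) (f := f) (by simp [N])
      (fun i _ => by simpa using hf i)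
    wlog hlt : i < j generalizing i j
    · exact this j hj i hi hij.symm hfij.symm (by omega)
    obtain ⟨d, rfl⟩ := Nat.exists_eq_add_of_lt hlt
    have hd : d + 1 ∣ N.factorial :=
      Nat.dvd_factorial (Nat.succ_pos d) (by rw [Finset.mem_range] at hj; omega)
    have hstep : v.op (m * (d + 1)) x - x =
        line (v.bar.rot ^ (m * i) * (z (i + d + 1) - z i)) := by
      rw [← v.op_bar_op (m * i) (sub_mem (v.op_mem _ (hXs hx)) (hXs hx)), ← Place.op_line]
      congr 1
      rw [map_sub, Place.op_op, show m * i + m * (d + 1) = m * (i + d + 1) by ring, hz, hz, hfij,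
        map_sub]
      abel
    obtain ⟨k, hk⟩ := hd
    rw [hk, ← mul_assoc]
    generalize m * (d + 1) = q at hstep
    generalize v.bar.rot ^ (m * i) * (z (i + d + 1) - z i) = u at hstep
    clear hk
    induction k with
    | zero => exact ⟨0, by simp [Place.op_zero]⟩
    | succ k ih =>
      obtain ⟨u', hu'⟩ := ih
      refine ⟨v.rot ^ q * u' + u, ?_⟩
      rw [mul_add, mul_one, add_comm, ← Place.op_op, map_add, ← Place.op_line, ← hu', ← hstep,
        map_sub]
      abel
  obtain ⟨u, hu⟩ := hleaf .five
  have hne : Place.five.rot ^ (m * N.factorial) - 1 ≠ 0 :=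
    sub_ne_zero.mpr (Place.rot_pow_ne_one _ hn)
  set n := m * N.factorial
  -- The translation along the leaf that turns `x` into a fixed point of `θ ^ n`, with `θ` the rotation
  -- at the place `five`; it also works at the other places, since the rotations commute and `θ ^ n` has
  -- no fixed point other than `0` on the complex leaf.
  set z := u / (Place.five.rot ^ n - 1)
  have h5 : Place.five.op n (x - line z) = x - line z := by
    have h1 : line (Place.five.rot ^ n * z) = line u + line z := by
      rw [← map_add]
      congr 1
      simp only [z]
      field_simp
      ring
    rw [map_sub, Place.op_line, h1, ← hu]
    abel
  refine ⟨z, fun v => ?_⟩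
  obtain ⟨uv, huv⟩ := hleaf v
  have h2 : v.op n (x - line z) - (x - line z) = line (uv - (v.rot ^ n * z - z)) := by
    rw [map_sub, Place.op_line, map_sub, map_sub, ← huv]
    abel
  have h3 : line (Place.five.rot ^ n * (uv - (v.rot ^ n * z - z))) =
      line (uv - (v.rot ^ n * z - z)) := by
    rw [← Place.op_line, ← h2, map_sub, Place.op_comm, h5]
  have h4 := line_injective h3
  have h5 : (Place.five.rot ^ n - 1) * (uv - (v.rot ^ n * z - z)) = 0 := by
    rw [sub_mul, h4, one_mul, sub_self]
  rw [(mul_eq_zero.mp h5).resolve_left hne, map_zero] at h2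
  exact sub_eq_zero.mp h2

/-- The fixed points of a power of a rotation are torsion points, of an order that depends only on
the power. -/
theorem exists_nat_smul_eq_zero {m : ℕ} (hm : 0 < m) : ∃ n : ℕ, 1 ≤ n ∧
    ∀ τ ∈ solenoid, Place.five.op m τ = τ → ∀ l, (n : GaussianInt) • τ l = 0 := by
  set g : GaussianInt := Place.five.num ^ m - 65 ^ m with hg
  have hg0 : g ≠ 0 := by
    intro h0
    apply Place.five.rot_pow_ne_one hm
    rw [← Place.num_div, div_pow, ← toComplex_pow, sub_eq_zero.mp h0, toComplex_pow,
      toComplex_sixtyFive, div_self (pow_ne_zero _ (by norm_num))]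
  refine ⟨g.norm.natAbs, ?_, fun τ hτ hfix l => ?_⟩
  · have := GaussianInt.norm_pos.mpr hg0
    omega
  · have h1 : g • τ (l + m) = 0 := by
      rw [hg, sub_smul, solenoid_pow_smul hτ, sub_eq_zero]
      exact congrFun hfix l
    have h2 : g • τ l = 0 := by
      rw [← solenoid_pow_smul hτ l m, smul_comm, h1, smul_zero]
    have h3 : (g.norm.natAbs : GaussianInt) = star g * g := by
      rw [mul_comm, ← Zsqrtd.norm_eq_mul_conj, ← Int.cast_natCast, GaussianInt.abs_natCast_norm]
    rw [h3, mul_smul, h2, smul_zero]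

/-- A torsion point of the solenoid with first coordinate `1 / 2 ^ (k + 1)`, and a power of the
rotations that fixes it. -/
theorem exists_torsion_point (k : ℕ) : ∃ τ ∈ solenoid, τ 0 = proj (1 / 2 ^ (k + 1)) ∧
    ∀ v : Place, v.op (2 * 2 ^ k) τ = τ := by
  obtain ⟨a, b, hab⟩ : IsCoprime (65 : ℤ) (2 ^ (k + 1)) :=
    IsCoprime.pow_right ⟨1, -32, by norm_num⟩
  have hab' : (a : GaussianInt) * 65 + b * 2 ^ (k + 1) = 1 := by exact_mod_cast hab
  have habc : (a : ℂ) * 65 + b * 2 ^ (k + 1) = 1 := by exact_mod_cast hab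
  have h2 : (2 : ℂ) ^ (k + 1) ≠ 0 := pow_ne_zero _ two_ne_zero
  refine ⟨fun l => proj (((a : GaussianInt) ^ l : GaussianInt) / 2 ^ (k + 1)), fun l => ?_,
    by simp, fun v => ?_⟩
  · rw [← proj_mul, proj_eq_iff]
    refine ⟨-(a ^ l * b), ?_⟩
    simp only [map_pow, map_neg, map_mul, map_intCast, toComplex_sixtyFive]
    field_simp
    linear_combination (a : ℂ) ^ l * habc
  · have hv : (2 : GaussianInt) ∣ v.num ^ 2 - 1 := by
      cases v
      · exact ⟨⟨-592, 2028⟩, by decide⟩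
      · exact ⟨⟨-592, -2028⟩, by decide⟩
      · exact ⟨⟨-1488, 1500⟩, by decide⟩
      · exact ⟨⟨-1488, -1500⟩, by decide⟩
    have ha : (2 : GaussianInt) ∣ (a : GaussianInt) - 1 :=
      ⟨-32 * a - 2 ^ k * b, by linear_combination hab'⟩
    have hu : ((2 : ℕ) : GaussianInt) ∣ (v.num * a) ^ 2 - 1 := by
      have : (v.num * a) ^ 2 - 1 = (v.num ^ 2 - 1) * a ^ 2 + (a + 1) * ((a : GaussianInt) - 1) := by
        ring
      rw [this, Nat.cast_ofNat]
      exact dvd_add (hv.mul_right _) (ha.mul_left _)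
    obtain ⟨e, he⟩ := dvd_sub_pow_of_dvd_sub hu k
    rw [one_pow, ← pow_mul, Nat.cast_ofNat] at he
    ext l
    rw [Place.op, scale_apply, ← proj_mul, proj_eq_iff]
    refine ⟨a ^ l * e, ?_⟩
    have he' := congrArg GaussianInt.toComplex he
    simp only [map_pow, map_mul, map_sub, map_one, map_intCast, map_ofNat] at he' ⊢
    field_simp
    rw [pow_add]
    linear_combination (a : ℂ) ^ l * he'

/-- The points of the set are not in the stripe at the level `0`. -/
def AvoidsStripe (ε : ℝ) (X : Set (ℕ → Torus)) : Prop := ∀ x ∈ X, x 0 ∉ proj '' stripe ε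

/-- A nonempty closed invariant set that avoids the stripe contains a point which is rational up to a
translation along its leaf. With a torsion point `τ` of first coordinate `1 / 2 ^ (k + 1) < ε`, let
`S i` consist of the `x` for which `x, x + τ, …, x + i • τ` all lie in the set. As multiples of `τ`
sweep across the stripe, `S i` is eventually empty; at the last nonempty stage, `τ` is not a
difference of two points of `S i`, so the differences do not accumulate at `0` transversally, and
`S i` meets only finitely many leaves. -/
theorem exists_fixed_of_avoidsStripe {ε : ℝ} (hε : 0 < ε) {X : Set (ℕ → Torus)} {m : ℕ}
    (hm : 0 < m) (hXc : IsClosed X) (hXs : X ⊆ solenoid) (hX : Invariant m X)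
    (hav : AvoidsStripe ε X) (hne : X.Nonempty) :
    ∃ x ∈ X, ∃ (z : ℂ) (n : ℕ), 0 < n ∧ ∀ v : Place, v.op n (x - line z) = x - line z := by
  obtain ⟨k, hk⟩ := exists_pow_lt_of_lt_one hε (by norm_num : (1 / 2 : ℝ) < 1)
  obtain ⟨τ, hτ, hτ0, hτfix⟩ := exists_torsion_point k
  set S : ℕ → Set (ℕ → Torus) := fun i => {x | ∀ j ≤ i, x + j • τ ∈ X} with hS
  have hS0 : (S 0).Nonempty := by
    obtain ⟨x, hx⟩ := hne
    exact ⟨x, fun j hj => by simpa [Nat.le_zero.mp hj] using hx⟩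
  have hSlast : ¬ (S (2 ^ (k + 1))).Nonempty := by
    rintro ⟨x, hx⟩
    obtain ⟨w, hw⟩ := proj_surjective (x 0)
    set r : ℝ := ⌈w.re⌉ - w.re with hr
    have hr0 : 0 ≤ r := sub_nonneg.mpr (Int.le_ceil _)
    have hr1 : r < 1 := by have := Int.ceil_lt_add_one w.re; linarith
    have ht : (0 : ℝ) < 2 ^ (k + 1) := by positivity
    set j := ⌊r * 2 ^ (k + 1)⌋₊ with hj
    have hj1 : (j : ℝ) ≤ r * 2 ^ (k + 1) := Nat.floor_le (by positivity)
    have hj2 : r * 2 ^ (k + 1) < j + 1 := Nat.lt_floor_add_one _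
    have hjt : j ≤ 2 ^ (k + 1) := by
      have : (j : ℝ) ≤ 2 ^ (k + 1) := hj1.trans (by nlinarith)
      exact_mod_cast this
    refine hav _ (hx j hjt) ⟨w + j / 2 ^ (k + 1), ⟨⌈w.re⌉, ?_⟩, ?_⟩
    · have hre : (w + (j : ℂ) / 2 ^ (k + 1)).re = w.re + j / 2 ^ (k + 1) := by
        have : (j : ℂ) / 2 ^ (k + 1) = ((j / 2 ^ (k + 1) : ℝ) : ℂ) := by push_cast; rfl
        rw [this, Complex.add_re, Complex.ofReal_re]
      have e1 : (j : ℝ) / 2 ^ (k + 1) ≤ r := (div_le_iff₀ ht).mpr hj1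
      have e2 : r < j / 2 ^ (k + 1) + 1 / 2 ^ (k + 1) := by
        rw [← add_div, lt_div_iff₀ ht]; exact hj2
      have e3 : (1 : ℝ) / 2 ^ (k + 1) < ε := by
        refine lt_of_le_of_lt ?_ hk
        rw [one_div_pow]
        exact one_div_le_one_div_of_le (by positivity) (pow_le_pow_right₀ (by norm_num) (by omega))
      rw [hre, abs_lt]
      constructor <;> linarith
    · have : (j : ℂ) / 2 ^ (k + 1) = ((j : GaussianInt) : ℂ) * (1 / 2 ^ (k + 1)) := by
        rw [map_natCast]; ring
      rw [map_add, hw, this, proj_mul, ← hτ0, Pi.add_apply, Pi.smul_apply, Nat.cast_smul_eq_nsmul]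
  classical
  have hex : ∃ i, ¬ (S i).Nonempty := ⟨_, hSlast⟩
  obtain ⟨i, hi⟩ : ∃ i, Nat.find hex = i + 1 := by
    refine Nat.exists_eq_succ_of_ne_zero fun h0 => ?_
    exact (h0 ▸ Nat.find_spec hex) hS0
  have hne' : (S i).Nonempty := not_not.mp (Nat.find_min hex (m := i) (by omega))
  have hem : ¬ (S (i + 1)).Nonempty := hi ▸ Nat.find_spec hex
  have hSX : S i ⊆ X := fun x hx => by simpa using hx 0 (Nat.zero_le _)
  have hSc : IsClosed (S i) := by
    have : S i = ⋂ j, ⋂ (_ : j ≤ i), (fun x => x + j • τ) ⁻¹' X := by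
      ext x; simp [hS]
    rw [this]
    exact isClosed_iInter fun j => isClosed_iInter fun _ =>
      hXc.preimage (continuous_id.add continuous_const)
  set M := m * (2 * 2 ^ k) with hM
  have hM0 : 0 < M := by positivity
  have hτM : ∀ v : Place, v.op M τ = τ := by
    have hinv : Invariant (2 * 2 ^ k) {τ} := fun v y hy => by
      rw [Set.mem_singleton_iff] at hy ⊢; rw [hy]; exact hτfix v
    exact fun v => hinv.of_dvd (Dvd.intro_left m rfl) v τ rfl
  have hSinv : Invariant M (S i) := fun v x hx j hj => by
    have := (hX.of_dvd (Dvd.intro _ rfl : m ∣ M)) v _ (hx j hj)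
    rwa [map_add, map_nsmul, hτM] at this
  set D : Set (ℕ → Torus) := (fun p : (ℕ → Torus) × (ℕ → Torus) => p.1 - p.2) '' (S i ×ˢ S i)
  have hDc : IsClosed D :=
    ((hSc.isCompact.prod hSc.isCompact).image (continuous_fst.sub continuous_snd)).isClosed
  have hDs : D ⊆ solenoid := by
    rintro _ ⟨⟨a, b⟩, ⟨ha, hb⟩, rfl⟩
    exact sub_mem (hXs (hSX ha)) (hXs (hSX hb))
  have hDinv : Invariant M D := by
    rintro v _ ⟨⟨a, b⟩, ⟨ha, hb⟩, rfl⟩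
    exact ⟨(v.op M a, v.op M b), ⟨hSinv v a ha, hSinv v b hb⟩, by simp⟩
  have hDacc : ¬ Accumulates D (line 0) := by
    intro hacc
    obtain ⟨⟨a, b⟩, ⟨ha, hb⟩, hab⟩ := solenoid_subset_of_accumulates hM0 hDc hDs hDinv hacc hτ
    refine hem ⟨b, fun j hj => ?_⟩
    rcases Nat.le_succ_iff.mp hj with hj | rfl
    · exact hb j hj
    · have : b + (i + 1) • τ = a + i • τ := by
        have hba : b + τ = a := by rw [← hab]; simp
        rw [succ_nsmul, ← hba]
        abel
      rw [this]
      exact ha i le_rfl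
  have hfin : MeetsFinitelyManyLeaves (S i) := by
    refine meetsFinitelyManyLeaves_of_not_accumulates hSc (hSX.trans hXs) fun x hx hacc => hDacc ?_
    intro l δ hδ
    obtain ⟨z, κ, hz, hκ, hκl, hκ0, hmem⟩ := hacc l δ hδ
    exact ⟨z, κ, hz, hκ, hκl, hκ0, (_, x), ⟨hmem, hx⟩, by simp; abel⟩
  obtain ⟨n, hn, -, hfix⟩ :=
    exists_fixed_of_meetsFinitelyManyLeaves hM0 (hSX.trans hXs) hSinv hfin
  obtain ⟨x, hx⟩ := hne'
  obtain ⟨z, hz⟩ := hfix x hx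
  exact ⟨x, hSX hx, z, n, hn, hz⟩

/-- The transversal accumulation points of a closed set within it form a closed set. -/
theorem isClosed_setOf_accumulates {X : Set (ℕ → Torus)} (hXc : IsClosed X)
    (hXs : X ⊆ solenoid) : IsClosed {x ∈ X | Accumulates X x} := by
  refine isClosed_of_closure_subset fun x hx => ?_
  have hxX : x ∈ X := hXc.closure_eq ▸ closure_mono (fun _ h => h.1) hx
  refine ⟨hxX, fun l δ hδ => ?_⟩
  obtain ⟨x', ⟨w, hw, hwx⟩, hx'X, hx'⟩ := mem_closure_iff.mp hx _
    (isOpen_setOf_apply_mem_proj_ball x l (δ / 2 / 65 ^ l)) ⟨0, by simpa using by positivity, by simp⟩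
  obtain ⟨κ, hκ, hκl, hxx⟩ :=
    exists_line_add (sub_mem (hXs hx'X) (hXs hxX)) (l := l) (w := w) hwx.symm
  have hnorm : ‖65 ^ l * w‖ < δ / 2 := by
    rw [mem_ball_zero_iff, lt_div_iff₀ (by positivity)] at hw
    rw [norm_mul, norm_pow, Complex.norm_ofNat]
    linarith
  by_cases hκ0 : κ = 0
  · obtain ⟨z, κ', hz, hκ', hκ'l, hκ'0, hmem⟩ := hx' l (δ / 2) (by positivity)
    refine ⟨65 ^ l * w + z, κ', (norm_add_le _ _).trans_lt (by linarith), hκ', hκ'l, hκ'0, ?_⟩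
    rw [hκ0, add_zero] at hxx
    rwa [map_add, ← hxx, show x + (x' - x + line z) + κ' = x' + line z + κ' by abel]
  · refine ⟨65 ^ l * w, κ, by linarith, hκ, hκl, hκ0, ?_⟩
    rwa [add_assoc, ← hxx, add_sub_cancel]

theorem Invariant.setOf_accumulates {X : Set (ℕ → Torus)} (hX : Invariant 1 X) :
    Invariant 1 {x ∈ X | Accumulates X x} := by
  rintro v x ⟨hxX, hx⟩
  refine ⟨hX v x hxX, fun l δ hδ => ?_⟩
  obtain ⟨z, κ, hz, hκ, hκl, hκ0, hmem⟩ := hx (l + 1) δ hδ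
  refine ⟨v.rot ^ 1 * z, v.op 1 κ, ?_, v.op_mem 1 hκ, ?_, fun h0 => hκ0 ?_, ?_⟩
  · rwa [norm_mul, norm_pow, v.norm_rot, one_pow, one_mul]
  · rw [Place.op, scale_apply, hκl, smul_zero]
  · rw [← v.op_bar_op 1 hκ, h0, map_zero]
  · rw [← Place.op_line, ← map_add, ← map_add]
    exact hX v _ hmem

/-- A closed invariant set that avoids the stripe meets only finitely many leaves. Otherwise its
transversal accumulation points contain a rational point up to translation along the leaf, and
translating by that point makes the set accumulate at the complex leaf: it would be the whole
solenoid, which contains `0`. -/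
theorem meetsFinitelyManyLeaves_of_avoidsStripe {ε : ℝ} (hε : 0 < ε) {X : Set (ℕ → Torus)}
    (hXc : IsClosed X) (hXs : X ⊆ solenoid) (hX : Invariant 1 X) (hav : AvoidsStripe ε X) :
    MeetsFinitelyManyLeaves X := by
  refine meetsFinitelyManyLeaves_of_not_accumulates hXc hXs fun x₀ hx₀ hacc₀ => ?_
  obtain ⟨x, ⟨hxX, hacc⟩, z, n, hn, hfix⟩ := exists_fixed_of_avoidsStripe hε one_pos
    (isClosed_setOf_accumulates hXc hXs) (fun x hx => hXs hx.1) hX.setOf_accumulates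
    (fun x hx => hav x hx.1) ⟨x₀, hx₀, hacc₀⟩
  have hτ : x - line z ∈ solenoid := sub_mem (hXs hxX) (line_mem z)
  have hsub := solenoid_subset_of_accumulates (Y := (fun y => y + (x - line z)) ⁻¹' X) hn
    (hXc.preimage (continuous_id.add continuous_const))
    (fun y hy => by simpa using sub_mem (hXs hy) hτ)
    (fun v y hy => by
      have := hX.of_dvd (one_dvd n) v _ hy
      rwa [map_add, hfix v] at this)
    (z₀ := z) (fun l δ hδ => by
      obtain ⟨z', κ, hz', hκ, hκl, hκ0, hmem⟩ := hacc l δ hδ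
      refine ⟨z', κ, hz', hκ, hκl, hκ0, ?_⟩
      rwa [Set.mem_preimage, show line z + line z' + κ + (x - line z) = x + line z' + κ by abel])
  have h0 := hsub (neg_mem hτ)
  rw [Set.mem_preimage, neg_add_cancel] at h0
  exact hav 0 h0 ⟨0, ⟨0, by simpa using hε⟩, by simp⟩

/-- The points of a closed invariant set that avoids the stripe are torsion points of bounded order up
to a translation of length at most `1` along the leaf: a longer translation would be rotated so as
to move the point into the stripe. -/
theorem exists_torsion_of_avoidsStripe {ε : ℝ} (hε : 0 < ε) {X : Set (ℕ → Torus)}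
    (hXc : IsClosed X) (hXs : X ⊆ solenoid) (hX : Invariant 1 X) (hav : AvoidsStripe ε X) :
    ∃ n : ℕ, 1 ≤ n ∧ ∀ x ∈ X, ∃ z : ℂ, ‖z‖ ≤ 1 ∧ ∀ l, (n : GaussianInt) • (x - line z) l = 0 := by
  obtain ⟨m, hm, -, hfix⟩ := exists_fixed_of_meetsFinitelyManyLeaves one_pos hXs hX
    (meetsFinitelyManyLeaves_of_avoidsStripe hε hXc hXs hX hav)
  obtain ⟨n, hn, htor⟩ := exists_nat_smul_eq_zero hm
  refine ⟨n, hn, fun x hx => ?_⟩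
  obtain ⟨z, hz⟩ := hfix x hx
  refine ⟨z, ?_, htor _ (sub_mem (hXs hx) (line_mem z)) (hz .five)⟩
  by_contra! hz1
  obtain ⟨w, hw⟩ := proj_surjective ((x - line z) 0)
  set r : ℝ := ⌈w.re⌉ - w.re with hr
  have hr0 : 0 ≤ r := sub_nonneg.mpr (Int.le_ceil _)
  have hr1 : r < 1 := by have := Int.ceil_lt_add_one w.re; linarith
  -- The point of the circle of radius `‖z‖` whose real part `r` moves `w` to an integral real part.
  set q : ℂ := ⟨r, √(‖z‖ ^ 2 - r ^ 2)⟩ with hq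
  have hqn : ‖q‖ = ‖z‖ := by
    rw [← sq_eq_sq₀ (norm_nonneg _) (norm_nonneg _), ← Complex.normSq_eq_norm_sq, hq,
      Complex.normSq_mk, Real.mul_self_sqrt (by nlinarith)]
    ring
  have hz0 : z ≠ 0 := by rw [← norm_pos_iff]; linarith
  obtain ⟨k, hk⟩ := exists_pow_near (ω := Place.five.rot ^ m)
    (by rw [norm_pow, Place.norm_rot, one_pow])
    (fun k hk => by rw [← pow_mul]; exact Place.rot_pow_ne_one _ (by positivity))
    (u := q / z) (by rw [norm_div, hqn, div_self (by simpa using hz0)])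
    (η := ε / ‖z‖) (by positivity)
  have hinv : Invariant m {x - line z} := fun v y hy => by
    rw [Set.mem_singleton_iff] at hy ⊢; rw [hy]; exact hz v
  have hτ : Place.five.op (m * k) (x - line z) = x - line z :=
    hinv.of_dvd (dvd_mul_right m k) .five _ rfl
  have hval : Place.five.op (m * k) x 0 = proj (Place.five.rot ^ (m * k) * z + w) := by
    rw [map_sub, sub_eq_iff_eq_add, Place.op_line] at hτ
    rw [hτ, Pi.add_apply, line_apply, map_add, hw, pow_zero, div_one, add_comm]
  refine hav _ (hX.of_dvd (one_dvd (m * k)) .five x hx) ⟨_, ⟨⌈w.re⌉, ?_⟩, hval.symm⟩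
  have h1 : ‖Place.five.rot ^ (m * k) * z - q‖ < ε := by
    have : Place.five.rot ^ (m * k) * z - q = ((Place.five.rot ^ m) ^ k - q / z) * z := by
      rw [pow_mul]; field_simp
    rw [this, norm_mul, ← lt_div_iff₀ (by linarith)]
    exact hk
  have h2 := (Complex.abs_re_le_norm _).trans_lt h1
  rw [Complex.sub_re] at h2
  have h3 : q.re = ⌈w.re⌉ - w.re := rfl
  rw [Complex.add_re, show (Place.five.rot ^ (m * k) * z).re + w.re - ⌈w.re⌉ =
    (Place.five.rot ^ (m * k) * z).re - q.re by rw [h3]; ring]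
  exact h2

/-! ### Uncovered points of the plane -/

theorem isOpen_stripe (ε : ℝ) : IsOpen (stripe ε) := by
  have : stripe ε = ⋃ m : ℤ, {z : ℂ | |z.re - m| < ε} := by
    ext z; simp [stripe]
  rw [this]
  exact isOpen_iUnion fun m =>
    isOpen_lt ((Complex.continuous_re.sub continuous_const).abs) continuous_const

theorem add_gaussianInt_mem_stripe {ε : ℝ} {z : ℂ} (hz : z ∈ stripe ε) (g : GaussianInt) :
    z + g ∈ stripe ε := by
  obtain ⟨m, hm⟩ := hz
  refine ⟨m + g.re, ?_⟩
  rw [Complex.add_re, ← GaussianInt.intCast_re]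
  push_cast
  rwa [add_sub_add_right_eq_sub]

theorem proj_mem_image_stripe {ε : ℝ} {z : ℂ} : proj z ∈ proj '' stripe ε ↔ z ∈ stripe ε := by
  refine ⟨fun ⟨w, hw, hwz⟩ => ?_, fun h => ⟨z, h, rfl⟩⟩
  obtain ⟨g, rfl⟩ := proj_eq_iff.mp hwz.symm
  exact add_gaussianInt_mem_stripe hw g

/-- Multiplication by `θ₅ ^ (b - a) * θ₁₃ ^ (d - c)` on the solenoid. -/
noncomputable def word (a b c d : ℕ) (y : ℕ → Torus) : ℕ → Torus :=
  Place.five.op a (Place.fiveBar.op b (Place.thirteen.op c (Place.thirteenBar.op d y)))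

theorem continuous_word (a b c d : ℕ) : Continuous (word a b c d) :=
  (Place.continuous_op _ _).comp <| (Place.continuous_op _ _).comp <|
    (Place.continuous_op _ _).comp (Place.continuous_op _ _)

/-- The points of the solenoid whose images under the rotations with exponents in a bounded range all
avoid the stripe at the level `0`. -/
def window (ε : ℝ) (M : ℕ) : Set (ℕ → Torus) :=
  {y | y ∈ solenoid ∧ ∀ a b c d, a ≤ M → b ≤ M → c ≤ M → d ≤ M →
    word a b c d y 0 ∉ proj '' stripe ε}

theorem isClosed_window (ε : ℝ) (M : ℕ) : IsClosed (window ε M) := by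
  have : window ε M = (solenoid : Set (ℕ → Torus)) ∩ ⋂ a, ⋂ b, ⋂ c, ⋂ d, ⋂ (_ : a ≤ M),
      ⋂ (_ : b ≤ M), ⋂ (_ : c ≤ M), ⋂ (_ : d ≤ M),
      (fun y => word a b c d y 0) ⁻¹' (proj '' stripe ε)ᶜ := by
    ext y; simp [window]
  rw [this]
  refine isClosed_solenoid.inter ?_
  refine isClosed_iInter fun a => isClosed_iInter fun b => isClosed_iInter fun c =>
    isClosed_iInter fun d => isClosed_iInter fun _ => isClosed_iInter fun _ =>
    isClosed_iInter fun _ => isClosed_iInter fun _ => ?_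
  exact (isOpenMap_proj _ (isOpen_stripe ε)).isClosed_compl.preimage
    ((continuous_apply 0).comp (continuous_word a b c d))

theorem window_antitone (ε : ℝ) : Antitone (window ε) := fun _ _ h _ hy =>
  ⟨hy.1, fun a b c d ha hb hc hd =>
    hy.2 a b c d (ha.trans h) (hb.trans h) (hc.trans h) (hd.trans h)⟩

theorem invariant_iInter_window (ε : ℝ) : Invariant 1 (⋂ M, window ε M) := by
  intro v y hy
  rw [Set.mem_iInter] at hy ⊢
  refine fun M => ⟨v.op_mem 1 (hy 0).1, fun a b c d ha hb hc hd => ?_⟩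
  have h := (hy (M + 1)).2
  cases v
  · have := h (a + 1) b c d (by omega) (by omega) (by omega) (by omega)
    rwa [word, ← Place.op_op, Place.op_comm .five .fiveBar 1, Place.op_comm .five .thirteen 1,
      Place.op_comm .five .thirteenBar 1] at this
  · have := h a (b + 1) c d (by omega) (by omega) (by omega) (by omega)
    rwa [word, ← Place.op_op, Place.op_comm .fiveBar .thirteen 1,
      Place.op_comm .fiveBar .thirteenBar 1] at this
  · have := h a b (c + 1) d (by omega) (by omega) (by omega) (by omega)
    rwa [word, ← Place.op_op, Place.op_comm .thirteen .thirteenBar 1] at this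
  · have := h a b c (d + 1) (by omega) (by omega) (by omega) (by omega)
    rwa [word, ← Place.op_op] at this

/-- By compactness, avoiding the stripe for finitely many rotations is enough to be close, at the
level `k`, to a rational point of bounded denominator `n`. -/
theorem exists_window_rational {ε : ℝ} (hε : 0 < ε) : ∃ n : ℕ, 1 ≤ n ∧ ∀ k : ℕ, ∃ M : ℕ,
    ∀ z : ℂ, line z ∈ window ε M → ∃ (w : ℂ) (g : GaussianInt), ‖w‖ ≤ 1 ∧
      ‖n * z - n * w - 65 ^ k * g‖ < 1 := by
  obtain ⟨n, hn, hX⟩ := exists_torsion_of_avoidsStripe hε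
    (isClosed_iInter fun M => isClosed_window ε M)
    (fun y hy => (Set.mem_iInter.mp hy 0).1) (invariant_iInter_window ε)
    (fun y hy => by
      have := (Set.mem_iInter.mp hy 0).2 0 0 0 0 le_rfl le_rfl le_rfl le_rfl
      simpa only [word, Place.op_zero] using this)
  refine ⟨n, hn, fun k => ?_⟩
  set U : Set (ℕ → Torus) := ⋃ w ∈ Metric.closedBall (0 : ℂ) 1,
    {y | (n : GaussianInt) • (y - line w) k ∈ proj '' Metric.ball 0 (1 / 65 ^ k)} with hU
  have hUo : IsOpen U := by
    refine isOpen_biUnion fun w _ => (isOpenMap_proj _ Metric.isOpen_ball).preimage ?_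
    exact (continuous_const_smul (n : GaussianInt)).comp
      ((continuous_apply k).comp (continuous_id.sub continuous_const))
  have hXU : ∀ x ∈ ⋂ M, window ε M, U ∈ nhds x := fun x hx => by
    obtain ⟨w, hw, h0⟩ := hX x hx
    exact hUo.mem_nhds (Set.mem_iUnion₂.mpr ⟨w, by simpa using hw, 0,
      Metric.mem_ball_self (by positivity), by rw [h0, map_zero]⟩)
  obtain ⟨M, hM⟩ := exists_subset_nhds_of_isCompact (window_antitone ε).directed_ge
    (fun M => (isClosed_window ε M).isCompact) hXU
  refine ⟨M, fun z hz => ?_⟩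
  obtain ⟨w, hw, s, hs, hsz⟩ := Set.mem_iUnion₂.mp (hM hz)
  rw [← map_sub, line_apply, ← proj_mul, eq_comm, proj_eq_iff, map_natCast] at hsz
  obtain ⟨g, hg⟩ := hsz
  refine ⟨w, g, by simpa using hw, ?_⟩
  have h1 : (n : ℂ) * z - n * w - 65 ^ k * g = 65 ^ k * s := by
    have h65 : (65 : ℂ) ^ k ≠ 0 := pow_ne_zero _ (by norm_num)
    field_simp at hg
    linear_combination hg
  rw [mem_ball_zero_iff, lt_div_iff₀ (by positivity)] at hs
  rw [h1, norm_mul, norm_pow, Complex.norm_ofNat]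
  linarith

theorem Place.toComplex_prime_ne_zero (v : Place) : (v.prime : ℂ) ≠ 0 := by
  simpa using v.prime_ne_zero

theorem rot_fiveBar : Place.fiveBar.rot = theta5 := by
  rw [Place.rot, rotation, Place.prime, star_star, theta5, GaussianInt.toComplex_star]

theorem rot_thirteenBar : Place.thirteenBar.rot = theta13 := by
  rw [Place.rot, rotation, Place.prime, star_star, theta13, GaussianInt.toComplex_star]

theorem rot_five_mul : Place.five.rot * theta5 = 1 := by
  have h1 : (P5 : ℂ) ≠ 0 := Place.toComplex_prime_ne_zero .five
  have h2 : ((star P5 : GaussianInt) : ℂ) ≠ 0 := Place.toComplex_prime_ne_zero .fiveBar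
  rw [← rot_fiveBar, Place.rot, Place.rot, rotation, rotation, Place.prime, Place.prime, star_star]
  field_simp

theorem rot_thirteen_mul : Place.thirteen.rot * theta13 = 1 := by
  have h1 : (P13 : ℂ) ≠ 0 := Place.toComplex_prime_ne_zero .thirteen
  have h2 : ((star P13 : GaussianInt) : ℂ) ≠ 0 := Place.toComplex_prime_ne_zero .thirteenBar
  rw [← rot_thirteenBar, Place.rot, Place.rot, rotation, rotation, Place.prime, Place.prime,
    star_star]
  field_simp

theorem theta5_ne_zero : theta5 ≠ 0 := right_ne_zero_of_mul_eq_one rot_five_mul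

theorem theta13_ne_zero : theta13 ≠ 0 := right_ne_zero_of_mul_eq_one rot_thirteen_mul

theorem not_mem_iUnion_rotatedStripe_iff {ε : ℝ} {N : ℕ} {z : ℂ} :
    z ∉ (⋃ θ ∈ Theta N, rotatedStripe ε θ) ↔
      ∀ a b : ℕ, a ≤ N → b ≤ N → theta5 ^ a * theta13 ^ b * z ∉ stripe ε := by
  have key : ∀ a b : ℕ, z ∈ rotatedStripe ε (theta5 ^ a * theta13 ^ b) ↔
      theta5 ^ a * theta13 ^ b * z ∈ stripe ε := fun a b =>
    Set.mem_inv_smul_set_iff₀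
      (mul_ne_zero (pow_ne_zero _ theta5_ne_zero) (pow_ne_zero _ theta13_ne_zero)) _ _
  simp only [Set.mem_iUnion, not_exists, Theta]
  constructor
  · exact fun h a b ha hb hz => h _ ⟨a, b, ha, hb, rfl⟩ ((key a b).mpr hz)
  · rintro h _ ⟨a, b, ha, hb, rfl⟩ hz
    exact h a b ha hb ((key a b).mp hz)

/-- All points of a given disc are covered by finitely many rotated stripes. -/
theorem exists_forall_norm_le_covered {ε : ℝ} (hε : 0 < ε) (ρ : ℝ) : ∃ N : ℕ, ∀ z : ℂ, ‖z‖ ≤ ρ →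
    ∃ a ≤ N, theta5 ^ a * z ∈ stripe ε := by
  have hcov : ∀ z : ℂ, ∃ a : ℕ, theta5 ^ a * z ∈ stripe ε := by
    intro z
    rcases eq_or_ne z 0 with rfl | hz
    · exact ⟨0, 0, by simpa using hε⟩
    have hz' : 0 < ‖z‖ := norm_pos_iff.mpr hz
    obtain ⟨a, ha⟩ := exists_pow_near (ω := theta5) (u := (‖z‖ : ℂ) * Complex.I / z)
      (rot_fiveBar ▸ Place.norm_rot _) (fun k hk => rot_fiveBar ▸ Place.rot_pow_ne_one _ hk)
      (by simp [hz]) (η := ε / ‖z‖) (by positivity)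
    refine ⟨a, 0, ?_⟩
    have h1 : theta5 ^ a * z - ‖z‖ * Complex.I =
        (theta5 ^ a - ‖z‖ * Complex.I / z) * z := by field_simp
    have h2 : ‖theta5 ^ a * z - ‖z‖ * Complex.I‖ < ε := by
      rwa [h1, norm_mul, ← lt_div_iff₀ hz']
    have h3 := (Complex.abs_re_le_norm _).trans_lt h2
    simpa using h3
  obtain ⟨t, ht⟩ := (isCompact_closedBall (0 : ℂ) ρ).elim_finite_subcover
    (fun a : ℕ => (fun z : ℂ => theta5 ^ a * z) ⁻¹' stripe ε)
    (fun a => (isOpen_stripe ε).preimage (continuous_const.mul continuous_id))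
    (fun z _ => Set.mem_iUnion.mpr (hcov z))
  refine ⟨t.sup id, fun z hz => ?_⟩
  obtain ⟨a, ha, hza⟩ := Set.mem_iUnion₂.mp (ht (mem_closedBall_zero_iff.mpr hz))
  exact ⟨a, Finset.le_sup (f := id) ha, hza⟩

/-- If `z` is uncovered for the exponents up to `2 * M + L`, then its rotations by
`(θ₅ * θ₁₃) ^ (M + j)` with `j ≤ L` are uncovered for the exponents in `[-M, M]`. -/
theorem line_mem_window {ε : ℝ} {M L j : ℕ} {z : ℂ}
    (hz : ∀ a b : ℕ, a ≤ 2 * M + L → b ≤ 2 * M + L → theta5 ^ a * theta13 ^ b * z ∉ stripe ε)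
    (hj : j ≤ L) : line ((theta5 * theta13) ^ (M + j) * z) ∈ window ε M := by
  refine ⟨line_mem _, fun a b c d ha hb hc hd => ?_⟩
  obtain ⟨a', rfl⟩ := Nat.exists_eq_add_of_le ha
  obtain ⟨c', hc'⟩ := Nat.exists_eq_add_of_le hc
  have h5 : Place.five.rot ^ a * theta5 ^ a = 1 := by rw [← mul_pow, rot_five_mul, one_pow]
  have h13 : Place.thirteen.rot ^ c * theta13 ^ c = 1 := by
    rw [← mul_pow, rot_thirteen_mul, one_pow]
  have heq : Place.five.rot ^ a * (theta5 ^ b * (Place.thirteen.rot ^ c * (theta13 ^ d *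
      ((theta5 * theta13) ^ (a + a' + j) * z)))) =
      theta5 ^ (a' + j + b) * theta13 ^ (c' + j + d) * z := by
    rw [mul_pow, show theta13 ^ (a + a' + j) = theta13 ^ c * theta13 ^ (c' + j) by
      rw [← pow_add, hc', add_assoc]]
    linear_combination theta5 ^ (a' + j + b) * theta13 ^ (c' + j + d) * z *
      ((Place.thirteen.rot ^ c * theta13 ^ c) * h5 + h13)
  rw [word, Place.op_line, Place.op_line, Place.op_line, Place.op_line, rot_fiveBar,
    rot_thirteenBar, heq, line_apply, pow_zero, div_one, proj_mem_image_stripe]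
  exact hz _ _ (by omega) (by omega)

/-- The product `P5 * P13`, of norm `65`. -/
def P65 : GaussianInt := P5 * P13

theorem P65_mul_star : P65 * star P65 = 65 := by decide

theorem isCoprime_P65 : IsCoprime P65 (star P65) := ⟨star P65 + 8, 8, by decide⟩

theorem P65_ne_zero : P65 ≠ 0 := by decide

theorem theta_mul_eq : theta5 * theta13 * (star P65 : GaussianInt) = P65 := by
  have h1 : ((star P5 : GaussianInt) : ℂ) ≠ 0 := Place.toComplex_prime_ne_zero .fiveBar
  have h2 : ((star P13 : GaussianInt) : ℂ) ≠ 0 := Place.toComplex_prime_ne_zero .thirteenBar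
  rw [P65, star_mul', map_mul, map_mul, theta5, theta13, ← GaussianInt.toComplex_star,
    ← GaussianInt.toComplex_star]
  field_simp

theorem norm_P65_sq : ‖(P65 : ℂ)‖ ^ 2 = 65 := by
  rw [← Complex.normSq_eq_norm_sq, ← GaussianInt.intCast_real_norm, show P65.norm = 65 by decide]
  norm_num

theorem norm_star_P65 : ‖((star P65 : GaussianInt) : ℂ)‖ = ‖(P65 : ℂ)‖ := by
  rw [GaussianInt.toComplex_star, Complex.norm_conj]

/-- Rounding is exact: the rational points near `z` and near `θ₅ * θ₁₃ * z` correspond to each other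
under `θ₅ * θ₁₃ = P65 / star P65`, since the error `18 * (n + 1)` is less than the spacing `65 ^ k`. -/
theorem P65_mul_eq {n k : ℕ} (hk : 18 * ((n : ℝ) + 1) < 65 ^ k) {z z' w w' : ℂ}
    {g g' : GaussianInt} (hz : z' = theta5 * theta13 * z) (hw : ‖w‖ ≤ 1) (hw' : ‖w'‖ ≤ 1)
    (h : ‖n * z - n * w - 65 ^ k * g‖ < 1) (h' : ‖n * z' - n * w' - 65 ^ k * g'‖ < 1) :
    P65 * g = star P65 * g' := by
  rw [← sub_eq_zero]
  by_contra hne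
  have h1 := one_le_norm_gaussianInt hne
  set s := n * z - n * w - 65 ^ k * g with hs
  set s' := n * z' - n * w' - 65 ^ k * g' with hs'
  have hP : ‖(P65 : ℂ)‖ ≤ 9 := by nlinarith [norm_P65_sq, norm_nonneg (P65 : ℂ)]
  have hb : ∀ v t : ℂ, ‖v‖ ≤ 1 → ‖t‖ < 1 → ‖(n : ℂ) * v + t‖ ≤ n + 1 := by
    intro v t hv ht
    refine (norm_add_le _ _).trans (add_le_add ?_ ht.le)
    rw [norm_mul, Complex.norm_natCast]
    exact mul_le_of_le_one_right (Nat.cast_nonneg n) hv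
  have h2 : (65 : ℂ) ^ k * ((P65 * g - star P65 * g' : GaussianInt) : ℂ) =
      (star P65 : GaussianInt) * (n * w' + s') - P65 * (n * w + s) := by
    rw [hs, hs', hz, map_sub, map_mul, map_mul]
    linear_combination (-(n : ℂ) * z) * theta_mul_eq
  have h3 : ‖(65 : ℂ) ^ k * ((P65 * g - star P65 * g' : GaussianInt) : ℂ)‖ ≤
      9 * (n + 1) + 9 * (n + 1) := by
    rw [h2]
    refine (norm_sub_le _ _).trans (add_le_add ?_ ?_)
    · rw [norm_mul, norm_star_P65]
      exact mul_le_mul hP (hb _ _ hw' h') (norm_nonneg _) (by norm_num)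
    · rw [norm_mul]
      exact mul_le_mul hP (hb _ _ hw h) (norm_nonneg _) (by norm_num)
  rw [norm_mul, norm_pow, Complex.norm_ofNat] at h3
  have h4 : (65 : ℝ) ^ k ≤ 65 ^ k * ‖((P65 * g - star P65 * g' : GaussianInt) : ℂ)‖ :=
    le_mul_of_one_le_right (by positivity) h1
  linarith

/-- The number `star P65 ^ A` clears the denominator of `θ₅ ^ a`. -/
theorem exists_theta_mul_star_P65_pow {a A : ℕ} (ha : a ≤ A) : ∃ g : GaussianInt,
    (g : ℂ) = theta5 ^ a * (star P65 ^ A : GaussianInt) := by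
  obtain ⟨d, rfl⟩ := Nat.exists_eq_add_of_le ha
  have h1 : ((star P5 : GaussianInt) : ℂ) ≠ 0 := Place.toComplex_prime_ne_zero .fiveBar
  refine ⟨P5 ^ a * star P13 ^ a * star P65 ^ d, ?_⟩
  rw [theta5, ← GaussianInt.toComplex_star, pow_add]
  rw [show star P65 ^ a = star P5 ^ a * star P13 ^ a by rw [← mul_pow, ← star_mul', P65]]
  simp only [map_mul, map_pow, div_pow]
  field_simp

end Pyjama

theorem mainTheorem2 (ε : ℝ) (hε : 0 < ε) :
    ∃ n : ℕ, 1 ≤ n ∧ ∀ R : ℝ, ∃ (D : GaussianInt) (N : ℕ),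
      R ≤ ‖(D : ℂ)‖ ∧
      ∀ z : ℂ, z ∉ (⋃ θ ∈ Pyjama.Theta N, Pyjama.rotatedStripe ε θ) →
        ∃ r : ℂ,
          r ∈ Pyjama.gaussianMultiples (1 / (n : ℂ) * (D : ℂ)) ∧
          r ∉ Pyjama.gaussianMultiples (D : ℂ) ∧
          dist z r ≤ 20 := by
  open Pyjama in
  obtain ⟨n, hn, hwin⟩ := exists_window_rational hε
  obtain ⟨k, hk⟩ := pow_unbounded_of_one_lt (18 * ((n : ℝ) + 1)) (by norm_num : (1 : ℝ) < 65)
  obtain ⟨M, hM⟩ := hwin k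
  obtain ⟨N₀, hN₀⟩ := exists_forall_norm_le_covered hε 20
  refine ⟨n * 65 ^ M, Nat.mul_pos hn (by positivity), fun R => ?_⟩
  have hP1 : 1 < ‖(P65 : ℂ)‖ := by nlinarith [norm_P65_sq, norm_nonneg (P65 : ℂ)]
  obtain ⟨L₀, hL₀⟩ := pow_unbounded_of_one_lt R hP1
  set L := L₀ + N₀ with hL
  have hP0 : (P65 : ℂ) ≠ 0 := by simpa using P65_ne_zero
  have hPs0 : ((star P65 : GaussianInt) : ℂ) ≠ 0 := by
    rw [← norm_ne_zero_iff, norm_star_P65]; simpa using P65_ne_zero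
  refine ⟨star P65 ^ (M + L), 2 * M + L, ?_, fun z hz => ?_⟩
  · rw [toComplex_pow, norm_pow, norm_star_P65]
    exact hL₀.le.trans (pow_le_pow_right₀ hP1.le (by omega))
  rw [not_mem_iUnion_rotatedStripe_iff] at hz
  -- All the points `θ ^ (M + j) * z` with `j ≤ L` are close to rational points `65 ^ k * g j / n`.
  choose! w g hw hg using fun j (hj : j ≤ L) => hM _ (line_mem_window hz hj)
  have hpow : ∀ j ≤ L, P65 ^ j * g 0 = star P65 ^ j * g j := by
    intro j
    induction j with
    | zero => simp
    | succ j ih =>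
      intro hj
      have h1 := P65_mul_eq hk (by ring) (hw j (by omega)) (hw (j + 1) hj) (hg j (by omega))
        (hg (j + 1) hj)
      rw [pow_succ', mul_assoc, ih (by omega), mul_left_comm, h1]
      ring
  -- The rational points are rotated into each other exactly, which makes the first one divisible by a
  -- high power of `star P65`.
  obtain ⟨h, hh⟩ : star P65 ^ L ∣ g 0 :=
    (isCoprime_P65.symm.pow (m := L) (n := L)).dvd_of_dvd_mul_left ⟨_, hpow L le_rfl⟩
  set θ := theta5 * theta13 with hθ
  have hθn : ‖θ‖ = 1 := by
    rw [hθ, ← rot_fiveBar, ← rot_thirteenBar, norm_mul, Place.norm_rot, Place.norm_rot, one_mul]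
  have hθ0 : θ ≠ 0 := by rw [← norm_ne_zero_iff, hθn]; exact one_ne_zero
  have hn0 : (n : ℂ) ≠ 0 := Nat.cast_ne_zero.mpr (by omega)
  have hθP : θ = P65 / (star P65 : GaussianInt) := by
    rw [eq_div_iff hPs0, theta_mul_eq]
  set r : ℂ := 65 ^ k * g 0 / (n * θ ^ M) with hr
  have hdist : dist z r ≤ 20 := by
    have h1 := hg 0 (Nat.zero_le _)
    rw [add_zero] at h1
    have h2 : z - r = (n * (w 0) + (n * (θ ^ M * z) - n * w 0 - 65 ^ k * g 0)) / (n * θ ^ M) := by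
      rw [hr]
      field_simp
      ring
    have hn1 : (1 : ℝ) ≤ n := by exact_mod_cast hn
    rw [dist_eq_norm, h2, norm_div, norm_mul, norm_pow, hθn, one_pow, mul_one,
      Complex.norm_natCast, div_le_iff₀ (by linarith)]
    refine (norm_add_le _ _).trans ?_
    rw [norm_mul, Complex.norm_natCast]
    nlinarith [hw 0 (Nat.zero_le _)]
  refine ⟨r, ⟨65 ^ k * h * star P65 ^ M, ?_⟩, ?_, hdist⟩
  · have h65 : (65 : ℂ) = P65 * (star P65 : GaussianInt) := by
      rw [← map_mul, P65_mul_star, toComplex_sixtyFive]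
    rw [hr, hh, hθP]
    simp only [map_mul, map_pow, toComplex_sixtyFive, Nat.cast_mul, Nat.cast_pow, Nat.cast_ofNat]
    rw [show (65 : ℂ) ^ M = (P65 * (star P65 : GaussianInt)) ^ M by rw [h65], div_pow, mul_pow]
    field_simp
    ring
  -- If `r` were in `D ℤ[i]`, then `z` would be a translate of the covered point `z - r` by an element
  -- that the rotations `θ₅ ^ a` keep integral.
  · rintro ⟨e, he⟩
    obtain ⟨a, ha, hmem⟩ := hN₀ (z - r) (by rwa [← dist_eq_norm])
    obtain ⟨q, hq⟩ := exists_theta_mul_star_P65_pow (a := a) (A := M + L) (by omega)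
    refine hz a 0 (by omega) (Nat.zero_le _) ?_
    have h1 : theta5 ^ a * theta13 ^ 0 * z = theta5 ^ a * (z - r) + (q * e : GaussianInt) := by
      rw [map_mul, hq, he]
      ring
    rw [h1]
    exact add_gaussianInt_mem_stripe hmem _
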